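/- All graphs are finite and simple, and edge-colorings use colors in $\mathbb N$. For a graph $F$, an edge-colored graph $G$ is $F$-rainbow saturated if it contains no copy of $F$ whose edges have pairwise distinct colors, but the addition of any nonedge with any color creates such a copy. Let $rsat(n,F)$ be the minimum number of edges of an $n$-vertex graph that has an $F$-rainbow saturated coloring, and let $rSat(n,F)$ be the family of $n$-vertex graphs that have such a coloring and exactly $rsat(n,F)$ edges. A coloring is rainbow if all edges have different colors. A bad root of $G$ is a vertex $u$ of degree $2$ for which there are vertices $v,w$ with $N(u)=\{v,w\}$ and $N(v)=\{u,w\}$. For $m\ge 3$ let $W_m=K_2\vee\overline{K_{m-2}}$, so that $W_3$ is a triangle. Given integers $n_1,\dots,n_4\in\{3\}\cup\{6,7,8,\dots\}$ and $a_1,\dots,a_4\ge 0$, take disjoint copies of $W_{n_1},\dots,W_{n_4}$, choose in each $W_{n_i}$ a vertex $u_i$ of maximum degree, and make $u_1,u_2,u_3,u_4$ pairwise adjacent; then, for each $i$, add $a_i$ disjoint new triangles and join all of their vertices to $u_i$. Let $\mathscr F_n(C_5)$ be the family of all graphs obtained (up to isomorphism) in this way with $n_1+n_2+n_3+n_4+3(a_1+a_2+a_3+a_4)=n$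 and with $n_i=3$ for at least one $i$. Theorem. Let $n\ge 15$, and let $G$ be a graph on $n$ vertices that contains a bad root and has a rainbow coloring which is $C_5$-rainbow saturated. (1) If $G\in rSat(n,C_5)$, then $rsat(n,C_5)=2n-6$ and $G\in\mathscr F_n(C_5)$. (2) In any case $e(G)\ge 2n-6$, with equality if and only if $G\in\mathscr F_n(C_5)$. -/

import Mathlib

namespace RainbowSat

open SimpleGraph

/-- The edge-coloring `c` of `G` contains a rainbow copy of `F`: a (not necessarily induced) copy
of `F` in `G` all of whose edges have different colors. -/
def HasRainbowCopy {V W : Type*} (F : SimpleGraph W) (G : SimpleGraph V)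
    (c : G.EdgeLabeling ℕ) : Prop :=
  ∃ f : Copy F G, Function.Injective fun e : F.edgeSet => c (f.toHom.mapEdgeSet e)

/-- The coloring of `G + uv` which agrees with `c` on the edges of `G`
and gives the color `i` to the added edge `uv`. -/
noncomputable def addEdgeColoring {V : Type*} (G : SimpleGraph V) (c : G.EdgeLabeling ℕ)
    (u v : V) (i : ℕ) : (G ⊔ edge u v).EdgeLabeling ℕ := by
  classical
  exact fun e => if h : e.1 ∈ G.edgeSet then c ⟨e.1, h⟩ else i

/-- The graph `G` with the edge-coloring `c` is `F`-rainbow saturated. -/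
def IsRainbowSaturated {V W : Type*} (F : SimpleGraph W) (G : SimpleGraph V)
    (c : G.EdgeLabeling ℕ) : Prop :=
  ¬ HasRainbowCopy F G c ∧
    ∀ u v : V, u ≠ v → ¬ G.Adj u v → ∀ i : ℕ,
      HasRainbowCopy F (G ⊔ edge u v) (addEdgeColoring G c u v i)

/-- The rainbow saturation number `rsat(n, F)`. -/
noncomputable def rsat {W : Type*} (n : ℕ) (F : SimpleGraph W) : ℕ :=
  sInf {e : ℕ | ∃ G : SimpleGraph (Fin n),
    (∃ c : G.EdgeLabeling ℕ, IsRainbowSaturated F G c) ∧ G.edgeSet.ncard = e}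

/-- Membership of `G` in the family `rSat(n, F)`. -/
def MemRSat {V W : Type*} [Finite V] (n : ℕ) (F : SimpleGraph W) (G : SimpleGraph V) : Prop :=
  Nat.card V = n ∧ (∃ c : G.EdgeLabeling ℕ, IsRainbowSaturated F G c) ∧
    G.edgeSet.ncard = rsat n F

/-- A bad root of `G`: a vertex `u` of degree 2 with `N(u) = {v, w}` and `N(v) = {u, w}`
for some `v`, `w`. -/
def IsBadRoot {V : Type*} (G : SimpleGraph V) (u : V) : Prop :=
  (G.neighborSet u).ncard = 2 ∧
    ∃ v w : V, G.neighborSet u = {v, w} ∧ G.neighborSet v = {u, w}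

/-- `W_m`, the join of `K_2` (the vertices `0`, `1`) and `m - 2` isolated vertices. -/
def wGraph (m : ℕ) : SimpleGraph (Fin m) where
  Adj x y := x ≠ y ∧ (x.val < 2 ∨ y.val < 2)
  symm := ⟨fun _ _ h => ⟨h.1.symm, h.2.symm⟩⟩
  loopless := ⟨fun _ h => h.1 rfl⟩

/-- The graph `Ω`: the disjoint union of `W_{m 0}, …, W_{m 3}` together with all edges between
the four core vertices, the core vertex of `W_{m i}` being its vertex `0`. -/
def omegaGraph (m : Fin 4 → ℕ) : SimpleGraph (Σ i : Fin 4, Fin (m i)) where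
  Adj p q :=
    (∃ (i : Fin 4) (x y : Fin (m i)), p = ⟨i, x⟩ ∧ q = ⟨i, y⟩ ∧ (wGraph (m i)).Adj x y) ∨
      (p.1 ≠ q.1 ∧ p.2.val = 0 ∧ q.2.val = 0)
  symm := by
    refine ⟨?_⟩
    rintro p q (⟨i, x, y, hp, hq, h⟩ | ⟨h, hp, hq⟩)
    · exact Or.inl ⟨i, y, x, hq, hp, h.symm⟩
    · exact Or.inr ⟨h.symm, hq, hp⟩
  loopless := by
    refine ⟨?_⟩
    rintro p (⟨i, x, y, hp, hq, h⟩ | ⟨h, -, -⟩)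
    · rw [hp] at hq
      have hxy : x = y := by simpa using hq
      exact h.ne hxy
    · exact h rfl

/-- The graph `Ξ(a 0, a 1, a 2, a 3)` over `Ω`: for each `i` add `a i` disjoint triangles and join
all their vertices to the core vertex of `W_{m i}`. The vertices `((i, k), j)`, `j < 3`, form the
`k`-th triangle at the `i`-th core vertex. -/
def xiGraph (m a : Fin 4 → ℕ) :
    SimpleGraph ((Σ i : Fin 4, Fin (m i)) ⊕ ((Σ i : Fin 4, Fin (a i)) × Fin 3)) :=
  SimpleGraph.fromRel fun p q =>
    match p, q with
    | .inl p, .inl q => (omegaGraph m).Adj p q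
    | .inl p, .inr t => p.2.val = 0 ∧ p.1 = t.1.1
    | .inr _, .inl _ => False
    | .inr s, .inr t => s.1 = t.1

/-- Membership of `G`, up to isomorphism, in the family `𝓕_n(C_5)`: the graphs `Ξ` on `n` vertices
built from `W_{m i}` with `m i ∉ {0, 1, 2, 4, 5}`, at least one of which is a triangle. -/
def MemFamily {V : Type*} (n : ℕ) (G : SimpleGraph V) : Prop :=
  ∃ m a : Fin 4 → ℕ, (∀ i, m i = 3 ∨ 6 ≤ m i) ∧ (∃ i, m i = 3) ∧
    ∑ i, m i + 3 * ∑ i, a i = n ∧ Nonempty (G ≃g xiGraph m a)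

end RainbowSat

/-! For an injective coloring, being `C_5`-rainbow saturated depends on the graph alone: there is no
5-cycle, and for every nonadjacent pair and every edge some 4-edge path joins the pair and avoids
that edge (give the new edge the color of the forbidden one).

A bad root gives a triangle `u v w` with `u`, `v` of degree two. Paths starting at `u` have only two
shapes, and applying saturation to them shows that the other neighbors of `w` induce disjoint
triangles (`exists_outer_triangle`, `outer_eq_or_eq`), that each vertex not adjacent to `w` sees
exactly one of these neighbors (`outer_unique`), and that all such vertices hang on one triangle
(`far_outer_eq_or_adj`). This triangle together with `w` is a `K_4` core, and every other vertex has
exactly one neighbor in it (`exists_isCore`).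

Outside the core a path on four vertices would close to a 5-cycle through a core vertex, so the
components are triangles and stars. Saturation allows at most one star per core vertex
(`leaf_adj_center`), and a star with two leaves has at least four (`class_ncard`). So `G` is a graph
`Ξ` in which each `m i` is 1, 3 or at least 6, and the pendant triangle accounts for a 3. Such a
graph has `2n - 6` edges plus one for each `m i = 1` (`ncard_edgeSet_xiGraph`), which gives the
bound and the equality case.

For membership in `rSat` the bound `rsat ≤ 2n - 6` is also needed. It comes from one explicit
family, whose saturation reduces to a computation on 15 vertices (`pathSaturated_modelGraph`). -/

open SimpleGraph RainbowSat

/-! ### Rainbow saturation of injective colorings in terms of paths -/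

/-- `G` has no cycle of length five. -/
def CycleFiveFree {V : Type*} (G : SimpleGraph V) : Prop :=
  ∀ a b c d e : V, a ≠ b → a ≠ c → a ≠ d → a ≠ e → b ≠ c → b ≠ d → b ≠ e → c ≠ d → c ≠ e →
    d ≠ e → G.Adj a b → G.Adj b c → G.Adj c d → G.Adj d e → G.Adj e a → False

/-- `p x y z q` is a path of `G` which does not use the edge `e`. -/
structure IsPathAvoiding {V : Type*} (G : SimpleGraph V) (e : Sym2 V) (p x y z q : V) : Prop where
  px : G.Adj p x
  xy : G.Adj x y
  yz : G.Adj y z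
  zq : G.Adj z q
  hpy : p ≠ y
  hpz : p ≠ z
  hpq : p ≠ q
  hxz : x ≠ z
  hxq : x ≠ q
  hyq : y ≠ q
  e1 : e ≠ s(p, x)
  e2 : e ≠ s(x, y)
  e3 : e ≠ s(y, z)
  e4 : e ≠ s(z, q)

/-- Any two distinct nonadjacent vertices are joined by paths with four edges which have no edge
in common. -/
def PathSaturated {V : Type*} (G : SimpleGraph V) : Prop :=
  ∀ p q : V, p ≠ q → ¬ G.Adj p q → ∀ e : Sym2 V, ∃ x y z, IsPathAvoiding G e p x y z q

theorem cycleGraph_five_adj_iff : ∀ i j : Fin 5,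
    (cycleGraph 5).Adj i j ↔ j = i + 1 ∨ i = j + 1 := by
  decide

/-- The copy of the five-cycle on five given vertices. -/
def cycleFiveCopy {V : Type*} (G : SimpleGraph V) (f : Fin 5 → V) (hf : Function.Injective f)
    (h : ∀ i, G.Adj (f i) (f (i + 1))) : Copy (cycleGraph 5) G where
  toHom := ⟨f, by
    intro i j hij
    rcases (cycleGraph_five_adj_iff i j).1 hij with rfl | rfl
    · exact h i
    · exact (h j).symm⟩
  injective' := hf

theorem vec_five_injective {V : Type*} {a b c d e : V} (h1 : a ≠ b) (h2 : a ≠ c) (h3 : a ≠ d)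
    (h4 : a ≠ e) (h5 : b ≠ c) (h6 : b ≠ d) (h7 : b ≠ e) (h8 : c ≠ d) (h9 : c ≠ e) (h10 : d ≠ e) :
    Function.Injective ![a, b, c, d, e] := by
  intro i j hij
  fin_cases i <;> fin_cases j <;> simp_all

theorem cycleFiveFree_of_not_hasRainbowCopy {V : Type*} {G : SimpleGraph V} {R : G.EdgeLabeling ℕ}
    (hR : Function.Injective R) (h : ¬ HasRainbowCopy (cycleGraph 5) G R) : CycleFiveFree G := by
  intro a b c d e h1 h2 h3 h4 h5 h6 h7 h8 h9 h10 ab bc cd de ea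
  refine h ⟨cycleFiveCopy G ![a, b, c, d, e]
    (vec_five_injective h1 h2 h3 h4 h5 h6 h7 h8 h9 h10) ?_, ?_⟩
  · intro i
    fin_cases i
    exacts [ab, bc, cd, de, ea]
  · exact hR.comp (Hom.mapEdgeSet.injective _ (Copy.injective _))

/-- Add `pq` in the color of `e`. The rainbow 5-cycle must use `pq`, since `G` has no 5-cycle, and
what remains of it is a path that cannot contain `e`. -/
theorem pathSaturated_of_isRainbowSaturated {V : Type*} {G : SimpleGraph V}
    {R : G.EdgeLabeling ℕ} (hR : Function.Injective R)
    (h : IsRainbowSaturated (cycleGraph 5) G R) : PathSaturated G := by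
  classical
  have hfree := cycleFiveFree_of_not_hasRainbowCopy hR h.1
  intro p q hpq hn e
  -- If `e` is not an edge, any color serves, because paths of `G` avoid `e` anyway.
  obtain ⟨i0, hi0⟩ : ∃ i0 : ℕ, ∀ he : e ∈ G.edgeSet, R ⟨e, he⟩ = i0 := by
    by_cases he : e ∈ G.edgeSet
    · exact ⟨R ⟨e, he⟩, fun _ => rfl⟩
    · exact ⟨0, fun h => absurd h he⟩
  obtain ⟨f, hf⟩ := h.2 p q hpq hn i0
  have finj : Function.Injective f := Copy.injective f
  have hadj : ∀ i : Fin 5, (cycleGraph 5).Adj i (i + 1) := fun i =>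
    (cycleGraph_five_adj_iff _ _).2 (Or.inl rfl)
  have hor : ∀ i : Fin 5, G.Adj (f i) (f (i + 1)) ∨ s(f i, f (i + 1)) = s(p, q) := by
    intro i
    have := f.toHom.map_adj (hadj i)
    rw [sup_adj, edge_adj] at this
    rcases this with h | ⟨h, -⟩
    · exact Or.inl h
    · right
      rw [Sym2.eq_iff]
      exact h
  obtain ⟨i, hi⟩ : ∃ i, s(f i, f (i + 1)) = s(p, q) := by
    by_contra hcon
    push Not at hcon
    have hG : ∀ i, G.Adj (f i) (f (i + 1)) := fun i => (hor i).resolve_right (hcon i)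
    have hne : ∀ i j : Fin 5, i ≠ j → f i ≠ f j := fun i j hij h => hij (finj h)
    exact hfree (f 0) (f 1) (f 2) (f 3) (f 4) (hne _ _ (by decide)) (hne _ _ (by decide))
      (hne _ _ (by decide)) (hne _ _ (by decide)) (hne _ _ (by decide)) (hne _ _ (by decide))
      (hne _ _ (by decide)) (hne _ _ (by decide)) (hne _ _ (by decide)) (hne _ _ (by decide))
      (hG 0) (hG 1) (hG 2) (hG 3) (hG 4)
  have hedge : ∀ j, j ≠ i → s(f j, f (j + 1)) ≠ s(f i, f (i + 1)) := by
    intro j hj heq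
    have hh := Sym2.eq_iff.1 heq
    have : ∀ i j : Fin 5, j ≠ i → ¬ ((j = i ∧ j + 1 = i + 1) ∨ (j = i + 1 ∧ j + 1 = i)) := by decide
    apply this i j hj
    rcases hh with ⟨h1, h2⟩ | ⟨h1, h2⟩
    · exact Or.inl ⟨finj h1, finj h2⟩
    · exact Or.inr ⟨finj h1, finj h2⟩
  have hG : ∀ j, j ≠ i → G.Adj (f j) (f (j + 1)) := fun j hj =>
    (hor j).resolve_right fun h => hedge j hj (h.trans hi.symm)
  have hcol : ∀ j, j ≠ i → e ≠ s(f j, f (j + 1)) := by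
    intro j hj he
    have hji : (⟨s(j, j + 1), hadj j⟩ : (cycleGraph 5).edgeSet) = ⟨s(i, i + 1), hadj i⟩ := by
      apply hf
      have hmem : s(f j, f (j + 1)) ∈ G.edgeSet := hG j hj
      have hnot : s(f i, f (i + 1)) ∉ G.edgeSet := by rw [hi]; exact hn
      have e1 : addEdgeColoring G R p q i0 (f.toHom.mapEdgeSet ⟨s(j, j + 1), hadj j⟩) = i0 := by
        unfold addEdgeColoring
        rw [dif_pos (show (f.toHom.mapEdgeSet ⟨s(j, j + 1), hadj j⟩).1 ∈ G.edgeSet from hmem)]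
        subst he
        exact hi0 hmem
      have e2 : addEdgeColoring G R p q i0 (f.toHom.mapEdgeSet ⟨s(i, i + 1), hadj i⟩) = i0 := by
        unfold addEdgeColoring
        rw [dif_neg (show (f.toHom.mapEdgeSet ⟨s(i, i + 1), hadj i⟩).1 ∉ G.edgeSet from hnot)]
      exact e1.trans e2.symm
    have h2 := Sym2.eq_iff.1 (Subtype.ext_iff.1 hji)
    have : ∀ i j : Fin 5, j ≠ i → ¬ ((j = i ∧ j + 1 = i + 1) ∨ (j = i + 1 ∧ j + 1 = i)) := by decide
    exact this i j hj h2
  have hne : ∀ i j : Fin 5, i ≠ j → f i ≠ f j := fun i j hij h => hij (finj h)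
  have a1 := hG (i + 1) ((by decide : ∀ i : Fin 5, i + 1 ≠ i) i)
  have a2 := hG (i + 2) ((by decide : ∀ i : Fin 5, i + 2 ≠ i) i)
  have a3 := hG (i + 3) ((by decide : ∀ i : Fin 5, i + 3 ≠ i) i)
  have a4 := hG (i + 4) ((by decide : ∀ i : Fin 5, i + 4 ≠ i) i)
  have c1 := hcol (i + 1) ((by decide : ∀ i : Fin 5, i + 1 ≠ i) i)
  have c2 := hcol (i + 2) ((by decide : ∀ i : Fin 5, i + 2 ≠ i) i)
  have c3 := hcol (i + 3) ((by decide : ∀ i : Fin 5, i + 3 ≠ i) i)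
  have c4 := hcol (i + 4) ((by decide : ∀ i : Fin 5, i + 4 ≠ i) i)
  have r1 : i + 1 + 1 = i + 2 := (by decide : ∀ i : Fin 5, i + 1 + 1 = i + 2) i
  have r2 : i + 2 + 1 = i + 3 := (by decide : ∀ i : Fin 5, i + 2 + 1 = i + 3) i
  have r3 : i + 3 + 1 = i + 4 := (by decide : ∀ i : Fin 5, i + 3 + 1 = i + 4) i
  have r4 : i + 4 + 1 = i := (by decide : ∀ i : Fin 5, i + 4 + 1 = i) i
  rw [r1] at a1 c1
  rw [r2] at a2 c2
  rw [r3] at a3 c3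
  rw [r4] at a4 c4
  have n1 := hne (i + 1) (i + 3) ((by decide : ∀ i : Fin 5, i + 1 ≠ i + 3) i)
  have n2 := hne (i + 1) (i + 4) ((by decide : ∀ i : Fin 5, i + 1 ≠ i + 4) i)
  have n3 := hne (i + 1) i ((by decide : ∀ i : Fin 5, i + 1 ≠ i) i)
  have n4 := hne (i + 2) (i + 4) ((by decide : ∀ i : Fin 5, i + 2 ≠ i + 4) i)
  have n5 := hne (i + 2) i ((by decide : ∀ i : Fin 5, i + 2 ≠ i) i)
  have n6 := hne (i + 3) i ((by decide : ∀ i : Fin 5, i + 3 ≠ i) i)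
  generalize f i = v0, f (i + 1) = v1, f (i + 2) = v2, f (i + 3) = v3, f (i + 4) = v4 at *
  rcases Sym2.eq_iff.1 hi with ⟨rfl, rfl⟩ | ⟨rfl, rfl⟩
  · rw [Sym2.eq_swap] at c1 c2 c3 c4
    exact ⟨v4, v3, v2, a4.symm, a3.symm, a2.symm, a1.symm, n6.symm, n5.symm, n3.symm, n4.symm,
      n2.symm, n1.symm, c4, c3, c2, c1⟩
  · exact ⟨v2, v3, v4, a1, a2, a3, a4, n1, n2, n3, n4, n5, n6, c1, c2, c3, c4⟩

/-- Injectivity leaves at most one edge with the color of the new edge; a path avoiding it closes to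
a rainbow cycle. -/
theorem isRainbowSaturated_of_pathSaturated {V : Type*} {G : SimpleGraph V}
    {R : G.EdgeLabeling ℕ} (hR : Function.Injective R) (hfree : CycleFiveFree G)
    (hsat : PathSaturated G) : IsRainbowSaturated (cycleGraph 5) G R := by
  classical
  refine ⟨?_, ?_⟩
  · rintro ⟨f, -⟩
    have hG : ∀ i, G.Adj (f i) (f (i + 1)) := fun i =>
      f.toHom.map_adj ((cycleGraph_five_adj_iff _ _).2 (Or.inl rfl))
    have hne : ∀ i j : Fin 5, i ≠ j → f i ≠ f j := fun i j hij h => hij (Copy.injective f h)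
    exact hfree (f 0) (f 1) (f 2) (f 3) (f 4) (hne _ _ (by decide)) (hne _ _ (by decide))
      (hne _ _ (by decide)) (hne _ _ (by decide)) (hne _ _ (by decide)) (hne _ _ (by decide))
      (hne _ _ (by decide)) (hne _ _ (by decide)) (hne _ _ (by decide)) (hne _ _ (by decide))
      (hG 0) (hG 1) (hG 2) (hG 3) (hG 4)
  · intro p q hpq hn i
    obtain ⟨e, he⟩ : ∃ e : Sym2 V, ∀ e' : G.edgeSet, R e' = i → e'.1 = e := by
      by_cases h : ∃ e' : G.edgeSet, R e' = i
      · obtain ⟨e', he'⟩ := h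
        exact ⟨e'.1, fun e'' h'' => by rw [hR (h''.trans he'.symm)]⟩
      · exact ⟨s(p, q), fun e' h' => absurd ⟨e', h'⟩ h⟩
    obtain ⟨x, y, z, P⟩ := hsat p q hpq hn e
    have hq : (G ⊔ edge p q).Adj q p := Or.inr (by rw [edge_adj]; exact ⟨Or.inr ⟨rfl, rfl⟩, hpq.symm⟩)
    let f : Copy (cycleGraph 5) (G ⊔ edge p q) := cycleFiveCopy _ ![p, x, y, z, q]
      (vec_five_injective P.px.ne P.hpy P.hpz P.hpq P.xy.ne P.hxz P.hxq P.yz.ne P.hyq P.zq.ne) (by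
        intro j
        fin_cases j
        exacts [Or.inl P.px, Or.inl P.xy, Or.inl P.yz, Or.inl P.zq, hq])
    refine ⟨f, ?_⟩
    have hpath : ∀ d : (cycleGraph 5).edgeSet, (f.toHom.mapEdgeSet d).1 ∈ G.edgeSet →
        (f.toHom.mapEdgeSet d).1 ≠ e := by
      rintro ⟨d, hd⟩
      induction d with | _ a b
      have key : ∀ a : Fin 5, G.Adj (f a) (f (a + 1)) → s(f a, f (a + 1)) ≠ e := by
        intro a ha
        fin_cases a
        exacts [P.e1.symm, P.e2.symm, P.e3.symm, P.e4.symm, absurd ha.symm hn]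
      intro hmem
      rcases (cycleGraph_five_adj_iff a b).1 hd with rfl | rfl
      · exact key a hmem
      · have := key b (G.adj_symm hmem)
        rwa [Sym2.eq_swap] at this
    have hnew : ∀ d : (cycleGraph 5).edgeSet, (f.toHom.mapEdgeSet d).1 ∉ G.edgeSet →
        (f.toHom.mapEdgeSet d).1 = s(p, q) := by
      intro d hd
      have hm := (f.toHom.mapEdgeSet d).2
      generalize (f.toHom.mapEdgeSet d).1 = g at hd hm
      induction g with | _ a b
      rcases hm with h | h
      · exact absurd h hd
      · have h : (edge p q).Adj a b := h
        rw [edge_adj] at h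
        exact Sym2.eq_iff.2 h.1
    have hinj : Function.Injective f.toHom.mapEdgeSet :=
      Hom.mapEdgeSet.injective _ (Copy.injective _)
    intro d d' hdd
    apply hinj
    apply Subtype.ext
    simp only [addEdgeColoring] at hdd
    split_ifs at hdd with h1 h2 h2
    · exact congrArg (fun e => e.1) (hR hdd)
    · exact absurd (he _ hdd) (hpath d h1)
    · exact absurd (he _ hdd.symm) (hpath d' h2)
    · rw [hnew d h1, hnew d' h2]

/-! ### The surroundings of a pendant triangle -/

/-- The vertices `u`, `v`, `w` form a triangle in which `u` and `v` have degree two. -/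
structure PendantTriangle {V : Type*} (G : SimpleGraph V) (u v w : V) : Prop where
  left : ∀ t, G.Adj u t ↔ t = v ∨ t = w
  right : ∀ t, G.Adj v t ↔ t = u ∨ t = w

/-- `x` is a neighbor of the base `w` of a pendant triangle `u v w` outside this triangle. -/
def OuterNeighbor {V : Type*} (G : SimpleGraph V) (u v w x : V) : Prop :=
  G.Adj w x ∧ x ≠ u ∧ x ≠ v

theorem CycleFiveFree.elim {V : Type*} {G : SimpleGraph V} (hf : CycleFiveFree G) {a b c d e : V}
    (ab : G.Adj a b) (bc : G.Adj b c) (cd : G.Adj c d) (de : G.Adj d e) (ea : G.Adj e a)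
    (ac : a ≠ c) (ad : a ≠ d) (bd : b ≠ d) (be : b ≠ e) (ce : c ≠ e) : False :=
  hf a b c d e ab.ne ac ad ea.ne.symm bc.ne bd be cd.ne ce de.ne ab bc cd de ea

namespace PendantTriangle

variable {V : Type*} {G : SimpleGraph V} {u v w : V}

/-- Since `u` and `v` have no further neighbors, a 4-edge path from `u` to `x` is `u v w a x` or `u
w a b x`. Forbidding `uv` or `uw` selects one of the two shapes. -/
theorem paths (hp : PendantTriangle G u v w) (hs : PathSaturated G) {x : V}
    (xu : x ≠ u) (xv : x ≠ v) (xw : x ≠ w) (e : Sym2 V) :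
    (e ≠ s(u, v) ∧ ∃ a, OuterNeighbor G u v w a ∧ G.Adj a x ∧ e ≠ s(w, a) ∧ e ≠ s(a, x)) ∨
    (e ≠ s(u, w) ∧ ∃ a b, OuterNeighbor G u v w a ∧ G.Adj a b ∧ G.Adj b x ∧ a ≠ x ∧ b ≠ w ∧
      b ≠ u ∧ b ≠ v ∧ e ≠ s(w, a) ∧ e ≠ s(a, b) ∧ e ≠ s(b, x)) := by
  obtain ⟨a, b, c, P⟩ := hs u x xu.symm (by rw [hp.left]; tauto) e
  rcases (hp.left a).1 P.px with rfl | rfl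
  · rcases (hp.right b).1 P.xy with rfl | rfl
    · exact absurd rfl P.hpy
    · exact Or.inl ⟨P.e1, c, ⟨P.yz, P.hpz.symm, P.hxz.symm⟩, P.zq, P.e3, P.e4⟩
  · have hbv : b ≠ v := by
      rintro rfl
      rcases (hp.right c).1 P.yz with rfl | rfl
      · exact P.hpz rfl
      · exact P.hxz rfl
    have hcv : c ≠ v := by
      rintro rfl
      rcases (hp.right x).1 P.zq with rfl | rfl
      · exact xu rfl
      · exact xw rfl
    exact Or.inr ⟨P.e1, b, c, ⟨P.xy, P.hpy.symm, hbv⟩, P.yz, P.zq, P.hyq, P.hxz.symm, P.hpz.symm,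
      hcv, P.e2, P.e3, P.e4⟩

theorem outer_of_adj (hp : PendantTriangle G u v w) {x y : V} (xw : x ≠ w)
    (hxy : G.Adj x y) (xu : x ≠ u) (xv : x ≠ v) (hy : G.Adj w y) : OuterNeighbor G u v w y := by
  refine ⟨hy, ?_, ?_⟩
  · rintro rfl
    rcases (hp.left x).1 hxy.symm with rfl | rfl
    · exact xv rfl
    · exact xw rfl
  · rintro rfl
    rcases (hp.right x).1 hxy.symm with rfl | rfl
    · exact xu rfl
    · exact xw rfl

/-- Forbidding `uv` yields a path `w a' b' x`. An outer neighbor of `x` other than `a'`, `b'` would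
complete it to a 5-cycle, so `y` and `a` are the adjacent vertices `a'`, `b'`. -/
theorem outer_adj_of_common (hp : PendantTriangle G u v w) (hf : CycleFiveFree G)
    (hs : PathSaturated G) {x y a : V} (hx : OuterNeighbor G u v w x)
    (hy : OuterNeighbor G u v w y) (ha : OuterNeighbor G u v w a) (hya : y ≠ a)
    (xy : G.Adj x y) (xa : G.Adj x a) : G.Adj y a := by
  rcases hp.paths hs hx.2.1 hx.2.2 hx.1.ne.symm s(u, v) with ⟨h, -⟩ | ⟨-, a', b', h1, h2, h3, h4, h5, h6, h7, -⟩
  · exact absurd rfl h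
  · have key : ∀ t, OuterNeighbor G u v w t → G.Adj x t → t = a' ∨ t = b' := by
      intro t ht hxt
      by_contra hcon
      push Not at hcon
      exact hf.elim h1.1 h2 h3 hxt ht.1.symm h5.symm hx.1.ne h4 hcon.1.symm hcon.2.symm
    rcases key y hy xy with rfl | rfl <;> rcases key a ha xa with rfl | rfl
    · exact absurd rfl hya
    · exact h2
    · exact h2.symm
    · exact absurd rfl hya

/-- Forbidding `uw` gives one outer neighbor `y` of `x`. Forbidding `wy` then gives either a second
one, or a path `w a b x` in which `b = y`, as otherwise `w a b x y` is a 5-cycle. -/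
theorem exists_outer_triangle (hp : PendantTriangle G u v w) (hf : CycleFiveFree G)
    (hs : PathSaturated G) {x : V} (hx : OuterNeighbor G u v w x) :
    ∃ y z, OuterNeighbor G u v w y ∧ OuterNeighbor G u v w z ∧ G.Adj x y ∧ G.Adj x z ∧
      G.Adj y z := by
  rcases hp.paths hs hx.2.1 hx.2.2 hx.1.ne.symm s(u, w) with ⟨-, y, hy, hyx, -⟩ | ⟨h, -⟩
  swap
  · exact absurd rfl h
  rcases hp.paths hs hx.2.1 hx.2.2 hx.1.ne.symm s(w, y) with
    ⟨-, a, ha, hax, hne, -⟩ | ⟨-, a, b, ha, hab, hbx, hax, hbw, hbu, hbv, hne, -⟩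
  · have hya : y ≠ a := by rintro rfl; exact hne rfl
    exact ⟨y, a, hy, ha, hyx.symm, hax.symm,
      hp.outer_adj_of_common hf hs hx hy ha hya hyx.symm hax.symm⟩
  · have hya : y ≠ a := by rintro rfl; exact hne rfl
    have hby : b = y := by
      by_contra hby
      exact hf.elim ha.1 hab hbx hyx.symm hy.1.symm hbw.symm hx.1.ne hax hya.symm hby
    subst hby
    exact ⟨b, a, hy, ha, hyx.symm,
      (hp.outer_adj_of_common hf hs hy ha hx hax hab.symm hyx).symm, hab.symm⟩

/-- A third neighbor `t` would be adjacent to `z`, making `w y x z t` a 5-cycle. Hence the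
components among the outer neighbors are exactly triangles. -/
theorem outer_eq_or_eq (hp : PendantTriangle G u v w) (hf : CycleFiveFree G)
    (hs : PathSaturated G) {x y z t : V} (hx : OuterNeighbor G u v w x)
    (hy : OuterNeighbor G u v w y) (hz : OuterNeighbor G u v w z) (ht : OuterNeighbor G u v w t)
    (hxy : G.Adj x y) (hxz : G.Adj x z) (hyz : y ≠ z) (hxt : G.Adj x t) : t = y ∨ t = z := by
  by_contra hcon
  push Not at hcon
  exact hf.elim hy.1 hxy.symm hxz (hp.outer_adj_of_common hf hs hx hz ht hcon.2.symm hxz hxt)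
    ht.1.symm hx.1.ne hz.1.ne hyz hcon.1.symm hxt.ne

theorem exists_outer_adj (hp : PendantTriangle G u v w) (hs : PathSaturated G) {x : V}
    (xu : x ≠ u) (xv : x ≠ v) (xw : x ≠ w) : ∃ a, OuterNeighbor G u v w a ∧ G.Adj a x := by
  rcases hp.paths hs xu xv xw s(u, w) with ⟨-, y, hy, hyx, -⟩ | ⟨h, -⟩
  · exact ⟨y, hy, hyx⟩
  · exact absurd rfl h

theorem exists_outer_ne (hp : PendantTriangle G u v w) (hf : CycleFiveFree G)
    (hs : PathSaturated G) {x : V} (a : V) (hx : OuterNeighbor G u v w x) :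
    ∃ y, OuterNeighbor G u v w y ∧ G.Adj x y ∧ y ≠ a := by
  obtain ⟨y, z, hy, hz, hxy, hxz, hyz⟩ := hp.exists_outer_triangle hf hs hx
  by_cases h : y = a
  · exact ⟨z, hz, hxz, fun h' => hyz.ne (h.trans h'.symm)⟩
  · exact ⟨y, hy, hxy, h⟩

/-- Otherwise, for an outer neighbor `y ≠ a` of `x`, the cycle `w y x b a` has length five. -/
theorem outer_unique (hp : PendantTriangle G u v w) (hf : CycleFiveFree G)
    (hs : PathSaturated G) {b x a : V} (bw : b ≠ w) (hb : ¬ G.Adj w b)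
    (hx : OuterNeighbor G u v w x) (ha : OuterNeighbor G u v w a) (bx : G.Adj b x)
    (ba : G.Adj b a) : x = a := by
  by_contra hxa
  obtain ⟨y, hy, hxy, hya⟩ := hp.exists_outer_ne hf hs a hx
  have hyb : y ≠ b := by rintro rfl; exact hb hy.1
  exact hf.elim hy.1 hxy.symm bx.symm ba ha.1.symm hx.1.ne bw.symm hyb hya hxa

theorem outer_eq_of_adj (hf : CycleFiveFree G) {b b' x x' : V} (bw : b ≠ w) (bw' : b' ≠ w)
    (hb : ¬ G.Adj w b) (hb' : ¬ G.Adj w b')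
    (hx : OuterNeighbor G u v w x) (hx' : OuterNeighbor G u v w x') (bx : G.Adj b x)
    (bx' : G.Adj b' x') (hbb : G.Adj b b') : x = x' := by
  by_contra hxx
  have h1 : x ≠ b' := by rintro rfl; exact hb' hx.1
  have h2 : b ≠ x' := by rintro rfl; exact hb hx'.1
  exact hf.elim hx.1 bx.symm hbb bx' hx'.1.symm bw.symm bw'.symm h1 hxx h2

/-- With `xb` forbidden, a path from `u` cannot enter `b` through its only outer neighbor, so it
enters through another vertex not adjacent to `w`, whose outer neighbor is again `x`. -/
theorem exists_far_adj (hp : PendantTriangle G u v w) (hf : CycleFiveFree G)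
    (hs : PathSaturated G) {b x : V} (bu : b ≠ u) (bv : b ≠ v) (bw : b ≠ w) (hb : ¬ G.Adj w b)
    (hx : OuterNeighbor G u v w x) (bx : G.Adj b x) :
    ∃ b', b' ≠ w ∧ ¬ G.Adj w b' ∧ G.Adj b b' ∧ G.Adj b' x := by
  rcases hp.paths hs bu bv bw s(x, b) with
    ⟨-, a, ha, hab, -, hne⟩ | ⟨-, a, c, ha, hac, hcb, -, hcw, hcu, hcv, -, -, hne⟩
  · exact absurd (by rw [hp.outer_unique hf hs bw hb ha hx hab.symm bx]) hne
  · have hcx : c ≠ x := by rintro rfl; exact hne rfl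
    have hc : ¬ G.Adj w c := fun h =>
      hcx (hp.outer_unique hf hs bw hb ⟨h, hcu, hcv⟩ hx hcb.symm bx)
    have := outer_eq_of_adj hf bw hcw hb hc hx ha bx hac.symm hcb.symm
    subst this
    exact ⟨c, hcw, hc, hcb.symm, hac.symm⟩

/-- Each vertex other than `u`, `v`, `w` belongs to the branch of one outer triangle, and edges
avoiding `w` stay within a branch. It suffices to join `b` and `b'` by a path that avoids `w`. -/
theorem far_outer_eq_or_adj (hp : PendantTriangle G u v w) (hf : CycleFiveFree G)
    (hs : PathSaturated G) {b b' x x' : V} (bu : b ≠ u) (bv : b ≠ v) (bw : b ≠ w)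
    (bu' : b' ≠ u) (bv' : b' ≠ v) (bw' : b' ≠ w) (hb : ¬ G.Adj w b) (hb' : ¬ G.Adj w b')
    (hx : OuterNeighbor G u v w x) (hx' : OuterNeighbor G u v w x') (bx : G.Adj b x)
    (bx' : G.Adj b' x') : x = x' ∨ G.Adj x x' := by
  classical
  have trans : ∀ {a c d : V}, OuterNeighbor G u v w a → OuterNeighbor G u v w c →
      OuterNeighbor G u v w d → (a = c ∨ G.Adj a c) → (c = d ∨ G.Adj c d) →
      (a = d ∨ G.Adj a d) := by
    rintro a c d ha hc hd (rfl | hac) (rfl | hcd)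
    · exact Or.inl rfl
    · exact Or.inr hcd
    · exact Or.inr hac
    · by_cases had : a = d
      · exact Or.inl had
      · exact Or.inr (hp.outer_adj_of_common hf hs hc ha hd had hac.symm hcd)
  -- the branch of a vertex, described by an outer neighbor of `w`
  let Br : V → V → Prop := fun p a => OuterNeighbor G u v w a ∧ (G.Adj w p → p = a) ∧
    (¬ G.Adj w p → G.Adj p a)
  have exBr : ∀ p, p ≠ u → p ≠ v → p ≠ w → ∃ a, Br p a := by
    intro p pu pv pw
    by_cases h : G.Adj w p
    · exact ⟨p, ⟨h, pu, pv⟩, fun _ => rfl, fun h' => absurd h h'⟩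
    · obtain ⟨a, ha, hap⟩ := hp.exists_outer_adj hs pu pv pw
      exact ⟨a, ha, fun h' => absurd h' h, fun _ => hap.symm⟩
  have step : ∀ {p q a c : V}, p ≠ w → q ≠ w → Br p a → Br q c → G.Adj p q →
      a = c ∨ G.Adj a c := by
    rintro p q a c pw qw ⟨ha, ha1, ha2⟩ ⟨hc, hc1, hc2⟩ hpq
    by_cases h : G.Adj w p <;> by_cases h' : G.Adj w q
    · rw [← ha1 h, ← hc1 h']
      exact Or.inr hpq
    · left
      have := ha1 h
      subst this
      exact hp.outer_unique hf hs qw h' ha hc hpq.symm (hc2 h')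
    · left
      have := hc1 h'
      subst this
      exact hp.outer_unique hf hs pw h ha hc (ha2 h) hpq
    · exact Or.inl (outer_eq_of_adj hf pw qw h h' ha hc (ha2 h) (hc2 h') hpq)
  have stepne : ∀ {p q : V}, p ≠ u → p ≠ v → q ≠ w → G.Adj p q → p ≠ w → q ≠ u ∧ q ≠ v := by
    intro p q pu pv qw hpq pw
    constructor
    · rintro rfl
      rcases (hp.left p).1 hpq.symm with rfl | rfl
      · exact pv rfl
      · exact pw rfl
    · rintro rfl
      rcases (hp.right p).1 hpq.symm with rfl | rfl
      · exact pu rfl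
      · exact pw rfl
  have brb : Br b x := ⟨hx, fun h => absurd h hb, fun _ => bx⟩
  have brb' : Br b' x' := ⟨hx', fun h => absurd h hb', fun _ => bx'⟩
  by_cases hbb : b = b'
  · subst hbb
    exact Or.inl (hp.outer_unique hf hs bw hb hx hx' bx bx')
  by_cases hadj : G.Adj b b'
  · exact step bw bw' brb brb' hadj
  -- As `b` and `b'` are not adjacent to `w`, the path could meet `w` only in its middle. Then `p`
  -- would be an outer neighbor, that is `x`, and the path would start with the forbidden edge.
  obtain ⟨p, q, r, P⟩ := hs b b' hbb hadj s(b, x)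
  have pw : p ≠ w := by rintro rfl; exact hb P.px.symm
  have rw' : r ≠ w := by rintro rfl; exact hb' P.zq
  obtain ⟨pu, pv⟩ := stepne bu bv pw P.px bw
  by_cases hq : q = w
  · subst hq
    have : p = x := hp.outer_unique hf hs bw hb ⟨P.xy.symm, pu, pv⟩ hx P.px bx
    subst this
    exact absurd rfl P.e1
  · obtain ⟨qu, qv⟩ := stepne pu pv hq P.xy pw
    obtain ⟨ru, rv⟩ := stepne qu qv rw' P.yz hq
    obtain ⟨a, hpa⟩ := exBr p pu pv pw
    obtain ⟨c, hqc⟩ := exBr q qu qv hq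
    obtain ⟨d, hrd⟩ := exBr r ru rv rw'
    exact trans hx hpa.1 hx' (step bw pw brb hpa P.px) (trans hpa.1 hqc.1 hx'
      (step pw hq hpa hqc P.xy) (trans hqc.1 hrd.1 hx' (step hq rw' hqc hrd P.yz)
        (step rw' bw' hrd brb' P.zq)))

end PendantTriangle

/-! ### The core `K_4` -/

/-- The vertices `c 0, …, c 3` form a clique, every other vertex `p` has exactly one neighbor
in this clique, namely `c (ρ p)`, and the value of `ρ` is constant along the edges outside the
clique, each vertex outside the clique being on such an edge. -/
structure IsCore {V : Type*} (G : SimpleGraph V) (c : Fin 4 → V) (ρ : V → Fin 4) : Prop where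
  clique : ∀ i j, i ≠ j → G.Adj (c i) (c j)
  root_core : ∀ i, ρ (c i) = i
  adj_core : ∀ p, p ∉ Set.range c → ∀ j, G.Adj p (c j) ↔ j = ρ p
  root_eq : ∀ p q, p ∉ Set.range c → q ∉ Set.range c → G.Adj p q → ρ p = ρ q
  exists_adj : ∀ p, p ∉ Set.range c → ∃ q, q ∉ Set.range c ∧ G.Adj p q

theorem PendantTriangle.exists_isCore {V : Type*} {G : SimpleGraph V} {u v w t : V}
    (hp : PendantTriangle G u v w) (hf : CycleFiveFree G) (hs : PathSaturated G)
    (tu : t ≠ u) (tv : t ≠ v) (tw : t ≠ w) :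
    ∃ c ρ, IsCore G c ρ ∧ c 0 = w ∧ u ∉ Set.range c ∧ v ∉ Set.range c := by
  classical
  have huw : G.Adj u w := (hp.left w).2 (Or.inr rfl)
  have hvw : G.Adj v w := (hp.right w).2 (Or.inr rfl)
  have huv : G.Adj u v := (hp.left v).2 (Or.inl rfl)
  -- The core is `w` with the outer triangle carrying all vertices not adjacent to `w`. If there are
  -- no such vertices, any outer triangle does, and `t` ensures that one exists.
  obtain ⟨x, hx, hall⟩ : ∃ x, OuterNeighbor G u v w x ∧ ∀ b a, b ≠ u → b ≠ v → b ≠ w →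
      ¬ G.Adj w b → OuterNeighbor G u v w a → G.Adj b a → x = a ∨ G.Adj x a := by
    by_cases h : ∃ b, b ≠ u ∧ b ≠ v ∧ b ≠ w ∧ ¬ G.Adj w b
    · obtain ⟨b, bu, bv, bw, hb⟩ := h
      obtain ⟨x, hx, hxb⟩ := hp.exists_outer_adj hs bu bv bw
      refine ⟨x, hx, fun b' a bu' bv' bw' hb' ha hba => ?_⟩
      exact hp.far_outer_eq_or_adj hf hs bu bv bw bu' bv' bw' hb hb' hx ha hxb.symm hba
    · obtain ⟨x, hx, -⟩ := hp.exists_outer_adj hs tu tv tw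
      exact ⟨x, hx, fun b a h1 h2 h3 h4 => absurd ⟨b, h1, h2, h3, h4⟩ h⟩
  obtain ⟨y, z, hy, hz, hxy, hxz, hyz⟩ := hp.exists_outer_triangle hf hs hx
  let c : Fin 4 → V := ![w, x, y, z]
  have hc : ∀ p, p ∈ Set.range c ↔ p = w ∨ p = x ∨ p = y ∨ p = z := by
    intro p
    constructor
    · rintro ⟨i, rfl⟩
      fin_cases i <;> simp [c]
    · rintro (rfl | rfl | rfl | rfl)
      exacts [⟨0, rfl⟩, ⟨1, rfl⟩, ⟨2, rfl⟩, ⟨3, rfl⟩]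
  have hcl : ∀ i j, i ≠ j → G.Adj (c i) (c j) := by
    intro i j hij
    fin_cases i <;> fin_cases j <;> first | exact absurd rfl hij | skip
    exacts [hx.1, hy.1, hz.1, hx.1.symm, hxy, hxz, hy.1.symm, hxy.symm, hyz, hz.1.symm,
      hxz.symm, hyz.symm]
  have hcinj : Function.Injective c := by
    intro i j hij
    by_contra h
    exact (hcl i j h).ne hij
  have hno : ∀ p a, OuterNeighbor G u v w p → p ∉ Set.range c → a = x ∨ a = y ∨ a = z →
      ¬ G.Adj p a := by
    intro p a hpo hpc ha hpa
    rw [hc] at hpc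
    push Not at hpc
    rcases ha with rfl | rfl | rfl
    · rcases hp.outer_eq_or_eq hf hs hx hy hz hpo hxy hxz hyz.ne hpa.symm with h | h <;> tauto
    · rcases hp.outer_eq_or_eq hf hs hy hx hz hpo hxy.symm hyz hxz.ne hpa.symm with h | h <;> tauto
    · rcases hp.outer_eq_or_eq hf hs hz hx hy hpo hxz.symm hyz.symm hxy.ne hpa.symm with h | h <;>
        tauto
  have h0 : c 0 = w := rfl
  have hout : ∀ i, i ≠ 0 → OuterNeighbor G u v w (c i) := by
    intro i hi
    fin_cases i
    exacts [absurd rfl hi, hx, hy, hz]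
  have hxyz : ∀ i, i ≠ 0 → (c i = x ∨ c i = y ∨ c i = z) := by
    intro i hi
    fin_cases i <;> simp [c] at hi ⊢
  have hnear : ∀ p, p ∉ Set.range c → G.Adj w p → ∀ i, G.Adj p (c i) ↔ i = 0 := by
    intro p hpc hwp i
    constructor
    · intro hpi
      by_contra hi
      by_cases hpu : p = u
      · subst hpu
        rcases (hp.left _).1 hpi with h | h
        · exact (hout i hi).2.2 h
        · exact hi (hcinj h)
      · by_cases hpv : p = v
        · subst hpv
          rcases (hp.right _).1 hpi with h | h
          · exact (hout i hi).2.1 h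
          · exact hi (hcinj h)
        · exact hno p (c i) ⟨hwp, hpu, hpv⟩ hpc (hxyz i hi) hpi
    · rintro rfl
      exact hwp.symm
  have hfar : ∀ p, p ∉ Set.range c → ¬ G.Adj w p → p ≠ u ∧ p ≠ v ∧ p ≠ w := by
    intro p hpc hwp
    refine ⟨?_, ?_, fun h => hpc ((hc p).2 (Or.inl h))⟩
    · rintro rfl; exact hwp huw.symm
    · rintro rfl; exact hwp hvw.symm
  have hfar' : ∀ p a, p ∉ Set.range c → ¬ G.Adj w p → OuterNeighbor G u v w a → G.Adj p a →
      ∃ i, i ≠ 0 ∧ c i = a := by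
    intro p a hpc hwp ha hpa
    obtain ⟨pu, pv, pw⟩ := hfar p hpc hwp
    rcases hall p a pu pv pw hwp ha hpa with rfl | h
    · exact ⟨1, by decide, rfl⟩
    · rcases hp.outer_eq_or_eq hf hs hx hy hz ha hxy hxz hyz.ne h with rfl | rfl
      · exact ⟨2, by decide, rfl⟩
      · exact ⟨3, by decide, rfl⟩
  have hex : ∀ p, ∃ i, (∀ j, p = c j → i = j) ∧ (p ∉ Set.range c → ∀ j, G.Adj p (c j) ↔ j = i) := by
    intro p
    by_cases hpc : p ∈ Set.range c
    · obtain ⟨i, rfl⟩ := hpc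
      exact ⟨i, fun j h => hcinj h, fun h => absurd ⟨i, rfl⟩ h⟩
    · by_cases hwp : G.Adj w p
      · exact ⟨0, fun j h => absurd ⟨j, h.symm⟩ hpc, fun _ => hnear p hpc hwp⟩
      · obtain ⟨pu, pv, pw⟩ := hfar p hpc hwp
        obtain ⟨a, ha, hap⟩ := hp.exists_outer_adj hs pu pv pw
        obtain ⟨i, hi, rfl⟩ := hfar' p a hpc hwp ha hap.symm
        refine ⟨i, fun j h => absurd ⟨j, h.symm⟩ hpc, fun _ j => ⟨fun h => ?_, ?_⟩⟩
        · have hj : j ≠ 0 := by rintro rfl; exact hwp h.symm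
          exact hcinj (hp.outer_unique hf hs pw hwp (hout j hj) ha h hap.symm)
        · rintro rfl; exact hap.symm
  choose ρ hρ1 hρ2 using hex
  have huc : u ∉ Set.range c := by
    rw [hc]
    rintro (h | h | h | h)
    exacts [huw.ne h, hx.2.1 h.symm, hy.2.1 h.symm, hz.2.1 h.symm]
  have hvc : v ∉ Set.range c := by
    rw [hc]
    rintro (h | h | h | h)
    exacts [hvw.ne h, hx.2.2 h.symm, hy.2.2 h.symm, hz.2.2 h.symm]
  have hroot0 : ∀ p, p ∉ Set.range c → (G.Adj w p ↔ ρ p = 0) := by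
    intro p hpc
    rw [G.adj_comm]
    exact (hρ2 p hpc 0).trans eq_comm
  -- If `q` were not adjacent to `w`, then `p` would be its outer neighbor and so a core vertex.
  have hmixed : ∀ p q, p ∉ Set.range c → q ∉ Set.range c → G.Adj p q → G.Adj w p →
      G.Adj w q := by
    intro p q hpc hqc hpq hwp
    by_contra hwq
    obtain ⟨qu, qv, qw⟩ := hfar q hqc hwq
    obtain ⟨i, hi, rfl⟩ := hfar' q p hqc hwq (hp.outer_of_adj qw hpq.symm qu qv hwp) hpq.symm
    exact hpc ⟨i, rfl⟩
  refine ⟨c, ρ, ⟨hcl, fun i => hρ1 _ i rfl, hρ2, ?_, ?_⟩, rfl, huc, hvc⟩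
  · intro p q hpc hqc hpq
    by_cases hwp : G.Adj w p
    · rw [(hroot0 p hpc).1 hwp, (hroot0 q hqc).1 (hmixed p q hpc hqc hpq hwp)]
    · have hwq : ¬ G.Adj w q := fun h => hwp (hmixed q p hqc hpc hpq.symm h)
      have hp0 : ρ p ≠ 0 := fun h => hwp ((hroot0 p hpc).2 h)
      have hq0 : ρ q ≠ 0 := fun h => hwq ((hroot0 q hqc).2 h)
      exact hcinj (outer_eq_of_adj hf (hfar p hpc hwp).2.2 (hfar q hqc hwq).2.2 hwp hwq
        (hout _ hp0) (hout _ hq0) ((hρ2 p hpc _).2 rfl) ((hρ2 q hqc _).2 rfl) hpq)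
  · intro p hpc
    by_cases hwp : G.Adj w p
    · by_cases hpu : p = u
      · subst hpu
        exact ⟨v, hvc, huv⟩
      · by_cases hpv : p = v
        · subst hpv
          exact ⟨u, huc, huv.symm⟩
        · have hpo : OuterNeighbor G u v w p := ⟨hwp, hpu, hpv⟩
          obtain ⟨q, hq, hpq, -⟩ := hp.exists_outer_ne hf hs p hpo
          refine ⟨q, fun hqc => ?_, hpq⟩
          rw [hc] at hqc
          rcases hqc with h | h
          · exact hq.1.ne h.symm
          · exact hno p q hpo hpc h hpq
    · obtain ⟨pu, pv, pw⟩ := hfar p hpc hwp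
      have hp0 : ρ p ≠ 0 := fun h => hwp ((hroot0 p hpc).2 h)
      obtain ⟨q, hqw, hwq, hpq, -⟩ := hp.exists_far_adj hf hs pu pv pw hwp (hout _ hp0)
        ((hρ2 p hpc _).2 rfl)
      refine ⟨q, fun hqc => ?_, hpq⟩
      obtain ⟨i, rfl⟩ := hqc
      by_cases hi : i = 0
      · exact hqw (hi ▸ h0)
      · exact hwq (hout i hi).1

/-! ### The components outside the core: triangles and stars -/

/-- The vertices of `G` split into a set `T`, on which `G` is a disjoint union of triangles, and
four classes which span graphs `W_m` with centers `c i` and `d i` (single vertices if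
`c i = d i`); the vertices `c i` form a clique, all the vertices of a triangle in `T` are joined
to the same `c i`, and there are no other edges. -/
structure IsXiShape {V : Type*} (G : SimpleGraph V) (c d : Fin 4 → V) (ρ : V → Fin 4)
    (T : Set V) : Prop where
  c_notMem : ∀ i, c i ∉ T
  d_notMem : ∀ i, d i ∉ T
  root_c : ∀ i, ρ (c i) = i
  root_d : ∀ i, ρ (d i) = i
  adj_same : ∀ p q, p ∉ T → q ∉ T → ∀ i, ρ p = i → ρ q = i →
    (G.Adj p q ↔ p ≠ q ∧ ((p = c i ∨ p = d i) ∨ (q = c i ∨ q = d i)))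
  eq_of_d_eq : ∀ p, p ∉ T → d (ρ p) = c (ρ p) → p = c (ρ p)
  adj_diff : ∀ p q, p ∉ T → q ∉ T → ρ p ≠ ρ q → (G.Adj p q ↔ p = c (ρ p) ∧ q = c (ρ q))
  adj_mixed : ∀ p q, p ∉ T → q ∈ T → (G.Adj p q ↔ p = c (ρ q))
  root_eq : ∀ p q, p ∈ T → q ∈ T → G.Adj p q → ρ p = ρ q
  trans : ∀ p q r, p ∈ T → q ∈ T → r ∈ T → G.Adj p q → G.Adj q r → p ≠ r → G.Adj p r
  two : ∀ p, p ∈ T → ∃ a b, a ∈ T ∧ b ∈ T ∧ a ≠ b ∧ ∀ q, q ∈ T → (G.Adj p q ↔ q = a ∨ q = b)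

namespace IsCore

variable {V : Type*} {G : SimpleGraph V} {c : Fin 4 → V} {ρ : V → Fin 4}

/-- `p` lies on a triangle outside the core. -/
def OnTriangle (G : SimpleGraph V) (c : Fin 4 → V) (p : V) : Prop :=
  p ∉ Set.range c ∧ ∃ q r, q ∉ Set.range c ∧ r ∉ Set.range c ∧ G.Adj p q ∧ G.Adj p r ∧ G.Adj q r

/-- `p` is the center of a star component outside the core. -/
def IsCenter (G : SimpleGraph V) (c : Fin 4 → V) (p : V) : Prop :=
  p ∉ Set.range c ∧ ∀ z, z ∉ Set.range c → G.Adj p z → ∀ y, y ∉ Set.range c → G.Adj z y → y = p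

theorem adj_root (h : IsCore G c ρ) {p : V} (hp : p ∉ Set.range c) : G.Adj p (c (ρ p)) :=
  (h.adj_core p hp _).2 rfl

/-- Both ends of the path are joined to the same core vertex, which closes a 5-cycle. -/
theorem no_path (h : IsCore G c ρ) (hf : CycleFiveFree G) {p q r s : V} (hp : p ∉ Set.range c)
    (hq : q ∉ Set.range c) (hr : r ∉ Set.range c) (hs : s ∉ Set.range c) (pq : G.Adj p q)
    (qr : G.Adj q r) (rs : G.Adj r s) (hpr : p ≠ r) (hqs : q ≠ s) (hps : p ≠ s) : False := by
  have h1 : ρ s = ρ p := by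
    rw [h.root_eq p q hp hq pq, h.root_eq q r hq hr qr, h.root_eq r s hr hs rs]
  have h2 := h.adj_root hs
  rw [h1] at h2
  exact hf.elim (h.adj_root hp).symm pq qr rs h2 (fun e => hq ⟨_, e⟩) (fun e => hr ⟨_, e⟩) hpr
    hps hqs

theorem onTriangle_of_adj (h : IsCore G c ρ) (hf : CycleFiveFree G) {p q : V}
    (hp : OnTriangle G c p) (hq : q ∉ Set.range c) (pq : G.Adj p q) : OnTriangle G c q := by
  obtain ⟨hp, a, b, ha, hb, pa, pb, ab⟩ := hp
  by_cases hqa : q = a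
  · subst hqa
    exact ⟨hq, p, b, hp, hb, pq.symm, ab, pb⟩
  by_cases hqb : q = b
  · subst hqb
    exact ⟨hq, p, a, hp, ha, pq.symm, ab.symm, pa⟩
  exact (h.no_path hf hq hp ha hb pq.symm pa ab hqa pb.ne hqb).elim

theorem isCenter_or_leaf (h : IsCore G c ρ) (hf : CycleFiveFree G) {p : V}
    (hp : p ∉ Set.range c) (ht : ¬ OnTriangle G c p) :
    IsCenter G c p ∨ ∃ z, IsCenter G c z ∧ G.Adj p z ∧
      ∀ y, y ∉ Set.range c → G.Adj p y → y = z := by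
  by_cases hc : IsCenter G c p
  · exact Or.inl hc
  right
  unfold IsCenter at hc
  push Not at hc
  obtain ⟨z, hz, pz, y, hy, zy, hyp⟩ := hc hp
  have hnadj : ¬ G.Adj p y := fun hpy => ht ⟨hp, z, y, hz, hy, pz, hpy, zy⟩
  have hzc : IsCenter G c z := by
    refine ⟨hz, fun t hth zt t' ht' tt' => ?_⟩
    by_contra hne
    by_cases htp : t = p
    · subst htp
      have h1 : t' ≠ y := by rintro rfl; exact hnadj tt'
      exact h.no_path hf ht' hth hz hy tt'.symm zt.symm zy hne hyp.symm h1
    · by_cases ht'p : t' = p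
      · subst ht'p
        exact ht ⟨hp, t, z, hth, hz, tt'.symm, pz, zt.symm⟩
      · exact h.no_path hf ht' hth hz hp tt'.symm zt.symm pz.symm hne htp ht'p
  exact ⟨z, hzc, pz, fun t hth hpt => hzc.2 p hp pz.symm t hth hpt⟩

/-- This excludes two stars at one core vertex. A path from `l` to `p` avoiding `lz` starts with the
core vertex of their class. It cannot use that vertex again, so it reaches `p` through a leaf of
`p`; but the only other neighbor of that leaf is the same core vertex. -/
theorem leaf_adj_center (h : IsCore G c ρ) (hs : PathSaturated G) {l z p : V}
    (hl : l ∉ Set.range c) (hlz : ∀ y, y ∉ Set.range c → G.Adj l y → y = z)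
    (hp : IsCenter G c p) (hroot : ρ l = ρ p) (hne : l ≠ p) : G.Adj l p := by
  by_contra hadj
  obtain ⟨x, y, z', P⟩ := hs l p hne hadj s(l, z)
  by_cases hx : x ∈ Set.range c
  · obtain ⟨i, rfl⟩ := hx
    have hi := (h.adj_core l hl i).1 P.px
    have hz' : z' ∉ Set.range c := by
      rintro ⟨j, rfl⟩
      have hj := (h.adj_core p hp.1 j).1 P.zq.symm
      exact P.hxz (by rw [hi, hj, hroot])
    have hy : y ∉ Set.range c := by
      rintro ⟨j, rfl⟩
      have hj := (h.adj_core z' hz' j).1 P.yz.symm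
      have := h.root_eq _ _ hz' hp.1 P.zq
      exact P.xy.ne (by rw [hi, hj, this, hroot])
    exact P.hyq (hp.2 z' hz' P.zq.symm y hy P.yz.symm)
  · have := hlz x hx P.px
    subst this
    exact P.e1 rfl

/-- If there is a star component at the core vertex `c i`, then `d` is its center; otherwise `d`
is `c i`. -/
def StarCenter (G : SimpleGraph V) (c : Fin 4 → V) (ρ : V → Fin 4) (i : Fin 4) (d : V) : Prop :=
  (IsCenter G c d ∧ ρ d = i) ∨ (d = c i ∧ ∀ p, p ∉ Set.range c → ρ p = i → OnTriangle G c p)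

theorem exists_starCenter (h : IsCore G c ρ) (hf : CycleFiveFree G) (i : Fin 4) :
    ∃ d, StarCenter G c ρ i d := by
  by_cases hex : ∃ d, IsCenter G c d ∧ ρ d = i
  · obtain ⟨d, hd⟩ := hex
    exact ⟨d, Or.inl hd⟩
  · refine ⟨c i, Or.inr ⟨rfl, fun p hp hi => ?_⟩⟩
    by_contra ht
    rcases h.isCenter_or_leaf hf hp ht with hc | ⟨z, hz, pz, -⟩
    · exact hex ⟨p, hc, hi⟩
    · exact hex ⟨z, hz, by rw [← h.root_eq _ _ hp hz.1 pz, hi]⟩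

theorem eq_or_leaf_of_center (h : IsCore G c ρ) (hf : CycleFiveFree G) (hs : PathSaturated G)
    {d p : V} (hd : IsCenter G c d) (hroot : ρ p = ρ d) (hp : p ∉ Set.range c)
    (ht : ¬ OnTriangle G c p) :
    p = d ∨ (G.Adj p d ∧ ∀ y, y ∉ Set.range c → G.Adj p y → y = d) := by
  by_cases hpd : p = d
  · exact Or.inl hpd
  right
  suffices hadj : G.Adj p d from ⟨hadj, fun y hy hpy => hd.2 p hp hadj.symm y hy hpy⟩
  rcases h.isCenter_or_leaf hf hp ht with hc | ⟨z, hz, pz, hpz⟩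
  · obtain ⟨z, hz, pz⟩ := h.exists_adj p hp
    by_cases hzd : z = d
    · exact hzd ▸ pz
    · have := h.leaf_adj_center hs hz (hc.2 z hz pz) hd
        ((h.root_eq _ _ hp hz pz).symm.trans hroot) hzd
      exact absurd (hc.2 z hz pz d hd.1 this).symm hpd
  · exact h.leaf_adj_center hs hp hpz hd hroot hpd

theorem not_onTriangle_of_isCenter {p : V} (hp : IsCenter G c p) : ¬ OnTriangle G c p := by
  rintro ⟨-, q, r, hq, hr, pq, pr, qr⟩
  exact pr.ne (hp.2 q hq pq r hr qr).symm

theorem isXiShape (h : IsCore G c ρ) (hf : CycleFiveFree G) (hs : PathSaturated G)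
    {d : Fin 4 → V} (hd : ∀ i, StarCenter G c ρ i (d i)) :
    IsXiShape G c d ρ {p | OnTriangle G c p} := by
  have hcT : ∀ i, ¬ OnTriangle G c (c i) := fun i hi => hi.1 ⟨i, rfl⟩
  have hrd : ∀ i, ρ (d i) = i := by
    intro i
    rcases hd i with hi | hi
    · exact hi.2
    · rw [hi.1, h.root_core]
  have hcenter : ∀ p, p ∉ Set.range c → ¬ OnTriangle G c p → IsCenter G c (d (ρ p)) := by
    intro p hp ht
    rcases hd (ρ p) with hi | hi
    · exact hi.1
    · exact absurd (hi.2 p hp rfl) ht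
  have hmix : ∀ p q, ¬ OnTriangle G c p → OnTriangle G c q → (G.Adj p q ↔ p = c (ρ q)) := by
    intro p q hp hq
    constructor
    · intro hpq
      by_cases hpc : p ∈ Set.range c
      · obtain ⟨i, rfl⟩ := hpc
        rw [(h.adj_core q hq.1 i).1 hpq.symm]
      · exact absurd (h.onTriangle_of_adj hf hq hpc hpq.symm) hp
    · rintro rfl
      exact (h.adj_root hq.1).symm
  refine ⟨hcT, ?_, h.root_core, hrd, ?_, ?_, ?_, hmix, ?_, ?_, ?_⟩
  · intro i
    rcases hd i with hi | hi
    · exact not_onTriangle_of_isCenter hi.1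
    · rw [hi.1]; exact hcT i
  · intro p q hp hq i hpi hqi
    by_cases hpc : p ∈ Set.range c
    · obtain ⟨j, rfl⟩ := hpc
      rw [h.root_core] at hpi
      subst hpi
      by_cases hqc : q ∈ Set.range c
      · obtain ⟨k, rfl⟩ := hqc
        rw [h.root_core] at hqi
        subst hqi
        simp
      · have h1 : c j ≠ q := fun e => hqc ⟨j, e⟩
        have := h.adj_root hqc
        rw [hqi] at this
        simp [h1, this.symm]
    · by_cases hqc : q ∈ Set.range c
      · obtain ⟨j, rfl⟩ := hqc
        rw [h.root_core] at hqi
        subst hqi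
        have h1 : p ≠ c j := fun e => hpc ⟨j, e.symm⟩
        have := h.adj_root hpc
        rw [hpi] at this
        simp [h1, this]
      · have h1 : p ≠ c i := fun e => hpc ⟨i, e.symm⟩
        have h2 : q ≠ c i := fun e => hqc ⟨i, e.symm⟩
        have hdc := hcenter p hpc hp
        rw [hpi] at hdc
        have h3 := h.eq_or_leaf_of_center hf hs hdc (hpi.trans (hrd i).symm) hpc hp
        have h4 := h.eq_or_leaf_of_center hf hs hdc (hqi.trans (hrd i).symm) hqc hq
        constructor
        · intro hpq
          refine ⟨hpq.ne, ?_⟩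
          rcases h3 with h3 | h3
          · exact Or.inl (Or.inr h3)
          · exact Or.inr (Or.inr (h3.2 q hqc hpq))
        · rintro ⟨hne, (h5 | h5) | (h5 | h5)⟩
          · exact absurd h5 h1
          · rcases h4 with h4 | h4
            · exact absurd (h5.trans h4.symm) hne
            · rw [h5]; exact h4.1.symm
          · exact absurd h5 h2
          · rcases h3 with h3 | h3
            · exact absurd (h3.trans h5.symm) hne
            · rw [h5]; exact h3.1
  · intro p hp hdc
    by_contra hne
    by_cases hpc : p ∈ Set.range c
    · obtain ⟨j, rfl⟩ := hpc
      exact hne (by rw [h.root_core])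
    · exact (hcenter p hpc hp).1 ⟨_, hdc.symm⟩
  · intro p q hp hq hne
    by_cases hpc : p ∈ Set.range c
    · obtain ⟨i, rfl⟩ := hpc
      rw [h.root_core] at hne ⊢
      by_cases hqc : q ∈ Set.range c
      · obtain ⟨j, rfl⟩ := hqc
        rw [h.root_core] at hne ⊢
        simpa using h.clique i j hne
      · have h1 : q ≠ c (ρ q) := fun e => hqc ⟨_, e.symm⟩
        rw [G.adj_comm, h.adj_core q hqc]
        simp [h1, hne]
    · have h1 : p ≠ c (ρ p) := fun e => hpc ⟨_, e.symm⟩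
      by_cases hqc : q ∈ Set.range c
      · obtain ⟨j, rfl⟩ := hqc
        rw [h.root_core] at hne
        rw [h.adj_core p hpc]
        simp [h1, hne.symm]
      · simp only [h1, false_and, iff_false]
        exact fun hpq => hne (h.root_eq p q hpc hqc hpq)
  · exact fun p q hp hq hpq => h.root_eq p q hp.1 hq.1 hpq
  · rintro p q r hp hq hr hpq hqr hpr
    by_contra hn
    obtain ⟨hp, a, b, ha, hb, pa, pb, ab⟩ := hp
    have key : ∀ t, t ∉ Set.range c → G.Adj p t → t ≠ q → False := by
      intro t ht hpt htq
      refine h.no_path hf hr.1 hq.1 hp ht hqr.symm hpq.symm hpt hpr.symm htq.symm ?_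
      rintro rfl
      exact hn hpt
    by_cases haq : a = q
    · exact key b hb pb (fun e => ab.ne (haq.trans e.symm))
    · exact key a ha pa haq
  · intro p hp
    have hp' := hp
    obtain ⟨hp, a, b, ha, hb, pa, pb, ab⟩ := hp
    refine ⟨a, b, h.onTriangle_of_adj hf hp' ha pa, h.onTriangle_of_adj hf hp' hb pb, ab.ne,
      fun q hq => ⟨fun hpq => ?_, ?_⟩⟩
    · by_contra hcon
      push Not at hcon
      exact h.no_path hf hq.1 hp ha hb hpq.symm pa ab hcon.1 pb.ne hcon.2
    · rintro (rfl | rfl) <;> assumption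

/-- A class without a star is just `c i`; otherwise it consists of `c i`, the center `d i` and its
leaves. Sizes 4 and 5 fail because a path between two leaves needs a third leaf in its middle, and
forbidding an edge at that leaf forces a fourth. -/
theorem class_ncard (h : IsCore G c ρ) (hf : CycleFiveFree G) (hs : PathSaturated G) [Finite V]
    {d : Fin 4 → V} (hd : ∀ i, StarCenter G c ρ i (d i)) (i : Fin 4) :
    ({p | ¬ OnTriangle G c p ∧ ρ p = i}.ncard = 1 ∨
      {p | ¬ OnTriangle G c p ∧ ρ p = i}.ncard = 3 ∨
      6 ≤ {p | ¬ OnTriangle G c p ∧ ρ p = i}.ncard) ∧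
    (∀ u v, u ∉ Set.range c → v ∉ Set.range c → ρ u = i → G.Adj u v →
      (∀ y, y ∉ Set.range c → G.Adj u y → y = v) → (∀ y, y ∉ Set.range c → G.Adj v y → y = u) →
      {p | ¬ OnTriangle G c p ∧ ρ p = i}.ncard = 3) := by
  have hX := h.isXiShape hf hs hd
  have hcT : ∀ i, ¬ OnTriangle G c (c i) := fun i hi => hi.1 ⟨i, rfl⟩
  have hpair : ∀ u v, u ∉ Set.range c → (∀ y, y ∉ Set.range c → G.Adj u y → y = v) →
      ¬ OnTriangle G c u := by
    rintro u v hu huv ⟨-, q, r, hq, hr, uq, ur, qr⟩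
    exact qr.ne ((huv q hq uq).trans (huv r hr ur).symm)
  rcases hd i with ⟨hdc, hdi⟩ | ⟨hdi, hall⟩
  · set N := {p | p ∉ Set.range c ∧ G.Adj (d i) p} with hN
    have hdT := not_onTriangle_of_isCenter hdc
    have hNT : ∀ p ∈ N, ¬ OnTriangle G c p := fun p hp ht =>
      hdT (h.onTriangle_of_adj hf ht hdc.1 hp.2.symm)
    have hNi : ∀ p ∈ N, ρ p = i := fun p hp => by
      rw [← h.root_eq _ _ hdc.1 hp.1 hp.2, hdi]
    have heq : {p | ¬ OnTriangle G c p ∧ ρ p = i} = insert (c i) (insert (d i) N) := by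
      ext p
      constructor
      · rintro ⟨hp, hpi⟩
        by_cases hpc : p ∈ Set.range c
        · obtain ⟨j, rfl⟩ := hpc
          rw [h.root_core] at hpi
          exact Or.inl (by rw [hpi])
        · rcases h.eq_or_leaf_of_center hf hs hdc (hpi.trans hdi.symm) hpc hp with h1 | h1
          · exact Or.inr (Or.inl h1)
          · exact Or.inr (Or.inr ⟨hpc, h1.1.symm⟩)
      · rintro (rfl | rfl | hp)
        · exact ⟨hcT i, h.root_core i⟩
        · exact ⟨hdT, hdi⟩
        · exact ⟨hNT p hp, hNi p hp⟩
    have hcard : {p | ¬ OnTriangle G c p ∧ ρ p = i}.ncard = N.ncard + 2 := by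
      rw [heq, Set.ncard_insert_of_notMem, Set.ncard_insert_of_notMem]
      · exact fun hh => hh.2.ne rfl
      · rintro (hh | hh)
        · exact hdc.1 ⟨i, hh⟩
        · exact hh.1 ⟨i, rfl⟩
    rw [hcard]
    constructor
    · right
      obtain ⟨l, hl, hdl⟩ := h.exists_adj _ hdc.1
      by_cases hone : N = {l}
      · left
        rw [hone, Set.ncard_singleton]
      · right
        obtain ⟨l', hl', hne⟩ : ∃ l' ∈ N, l' ≠ l := by
          by_contra hcon
          push Not at hcon
          exact hone (Set.eq_singleton_iff_unique_mem.2 ⟨⟨hl, hdl⟩, hcon⟩)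
        have hlN : l ∈ N := ⟨hl, hdl⟩
        have hadj : ¬ G.Adj l l' := fun hll => hl'.2.ne (hdc.2 l hl hdl l' hl'.1 hll).symm
        -- A leaf has only the neighbors `c i` and `d i`, so the path runs `l, c i, y, d i, l'` or
        -- with `c i` and `d i` exchanged. In both cases it uses the edge between `c i` and `y`.
        have hmid : ∀ e, ∃ y ∈ N, y ≠ l ∧ y ≠ l' ∧ (e ≠ s(c i, y)) := by
          intro e
          obtain ⟨x, y, z, P⟩ := hs l l' hne.symm hadj e
          have hnb : ∀ m ∈ N, ∀ t, G.Adj m t → t = c i ∨ t = d i := by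
            intro m hm t hmt
            by_cases htc : t ∈ Set.range c
            · obtain ⟨j, rfl⟩ := htc
              left
              rw [(h.adj_core m hm.1 j).1 hmt, hNi m hm]
            · exact Or.inr (hdc.2 m hm.1 hm.2 t htc hmt)
          have hNof : ∀ y, G.Adj (d i) y → G.Adj (c i) y → y ∈ N := by
            intro y hy hy'
            refine ⟨?_, hy⟩
            rintro ⟨j, rfl⟩
            have := (h.adj_core _ hdc.1 j).1 hy
            exact hy'.ne (by rw [this, hdi])
          have hx := hnb l hlN x P.px
          have hz := hnb l' hl' z P.zq.symm
          rcases hx with rfl | rfl <;> rcases hz with rfl | rfl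
          · exact absurd rfl P.hxz
          · exact ⟨y, hNof y P.yz.symm P.xy, P.hpy.symm, P.hyq, P.e2⟩
          · refine ⟨y, hNof y P.xy P.yz.symm, P.hpy.symm, P.hyq, ?_⟩
            rw [Sym2.eq_swap]
            exact P.e3
          · exact absurd rfl P.hxz
        -- The loop `s(l, l)` is no edge, so nothing is forbidden here.
        obtain ⟨y1, hy1, h1, h1', -⟩ := hmid s(l, l)
        obtain ⟨y2, hy2, h2, h2', h2e⟩ := hmid s(c i, y1)
        have hy12 : y2 ≠ y1 := by rintro rfl; exact h2e rfl
        have hsub : ({y2, y1, l', l} : Set V) ⊆ N := by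
          rintro t (rfl | rfl | rfl | rfl) <;> assumption
        have hfour : ({y2, y1, l', l} : Set V).ncard = 4 := by
          rw [Set.ncard_insert_of_notMem, Set.ncard_insert_of_notMem,
            Set.ncard_insert_of_notMem, Set.ncard_singleton] <;> simp [*]
        have := Set.ncard_le_ncard hsub
        omega
    · intro u v hu hv hui huv hu' hv'
      have hcase := h.eq_or_leaf_of_center hf hs hdc (hui.trans hdi.symm) hu (hpair u v hu hu')
      suffices hone : ∃ t, N = {t} by
        obtain ⟨t, ht⟩ := hone
        rw [ht, Set.ncard_singleton]
      rcases hcase with hud | ⟨hud, -⟩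
      · refine ⟨v, Set.eq_singleton_iff_unique_mem.2 ⟨⟨hv, hud ▸ huv⟩, fun t ht => hu' t ht.1 ?_⟩⟩
        rw [hud]
        exact ht.2
      · have hdv := hu' _ hdc.1 hud
        refine ⟨u, Set.eq_singleton_iff_unique_mem.2 ⟨⟨hu, hud.symm⟩, fun t ht => hv' t ht.1 ?_⟩⟩
        rw [← hdv]
        exact ht.2
  · constructor
    · left
      rw [Set.ncard_eq_one]
      refine ⟨c i, Set.eq_singleton_iff_unique_mem.2 ⟨⟨hcT i, h.root_core i⟩, ?_⟩⟩
      rintro p ⟨hp, hpi⟩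
      by_contra hne
      refine hp (hall p ?_ hpi)
      rintro ⟨j, rfl⟩
      rw [h.root_core] at hpi
      exact hne (by rw [hpi])
    · intro u v hu hv hui huv hu' hv'
      exact absurd (hall u hu hui) (hpair u v hu hu')

end IsCore

/-! ### The isomorphism with `Ξ` -/

theorem omegaGraph_adj_same (m : Fin 4 → ℕ) (i : Fin 4) (x y : Fin (m i)) :
    (omegaGraph m).Adj ⟨i, x⟩ ⟨i, y⟩ ↔ x ≠ y ∧ (x.val < 2 ∨ y.val < 2) := by
  constructor
  · rintro (⟨j, x', y', h1, h2, h⟩ | ⟨h, -⟩)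
    · obtain rfl : i = j := congrArg Sigma.fst h1
      obtain rfl : x = x' := by simpa using h1
      obtain rfl : y = y' := by simpa using h2
      exact h
    · exact absurd rfl h
  · intro h
    exact Or.inl ⟨i, x, y, rfl, rfl, h⟩

theorem omegaGraph_adj_diff (m : Fin 4 → ℕ) {p q : Σ i : Fin 4, Fin (m i)} (h : p.1 ≠ q.1) :
    (omegaGraph m).Adj p q ↔ p.2.val = 0 ∧ q.2.val = 0 := by
  constructor
  · rintro (⟨j, x', y', h1, h2, -⟩ | h')
    · rw [h1, h2] at h
      exact absurd rfl h
    · exact h'.2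
  · intro h'
    exact Or.inr ⟨h, h'⟩

theorem xiGraph_adj_inl_inl (m a : Fin 4 → ℕ) (p q : Σ i : Fin 4, Fin (m i)) :
    (xiGraph m a).Adj (.inl p) (.inl q) ↔ (omegaGraph m).Adj p q := by
  simp only [xiGraph, fromRel_adj]
  constructor
  · rintro ⟨-, h | h⟩
    exacts [h, h.symm]
  · intro h
    exact ⟨fun e => h.ne (Sum.inl_injective e), Or.inl h⟩

theorem xiGraph_adj_inl_inr (m a : Fin 4 → ℕ) (p : Σ i : Fin 4, Fin (m i))
    (t : (Σ i : Fin 4, Fin (a i)) × Fin 3) :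
    (xiGraph m a).Adj (.inl p) (.inr t) ↔ p.2.val = 0 ∧ p.1 = t.1.1 := by
  simp [xiGraph, fromRel_adj]

theorem xiGraph_adj_inr_inr (m a : Fin 4 → ℕ) (s t : (Σ i : Fin 4, Fin (a i)) × Fin 3) :
    (xiGraph m a).Adj (.inr s) (.inr t) ↔ s ≠ t ∧ s.1 = t.1 := by
  simp only [xiGraph, fromRel_adj]
  constructor
  · rintro ⟨h, h' | h'⟩
    · exact ⟨fun e => h (congrArg _ e), h'⟩
    · exact ⟨fun e => h (congrArg _ e), h'.symm⟩
  · rintro ⟨h, h'⟩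
    exact ⟨fun e => h (Sum.inr_injective e), Or.inl h'⟩

/-- An enumeration of a finite type starting with one or two given elements. -/
theorem exists_equiv_fin_of_two {X : Type*} [Finite X] (x y : X) (hxy : y = x → ∀ z, z = x) :
    ∃ e : X ≃ Fin (Nat.card X), ∀ z, ((e z).val = 0 ↔ z = x) ∧ ((e z).val < 2 ↔ z = x ∨ z = y) := by
  classical
  have hpos : 0 < Nat.card X := Nat.card_pos_iff.2 ⟨⟨x⟩, inferInstance⟩
  let e0 := Finite.equivFin X
  let e1 := e0.trans (Equiv.swap (e0 x) ⟨0, hpos⟩)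
  have h1 : e1 x = ⟨0, hpos⟩ := by simp [e1]
  by_cases h : y = x
  · subst h
    refine ⟨e1, fun z => ?_⟩
    rw [hxy rfl z, h1]
    simp
  · have htwo : 1 < Nat.card X := by
      have : Nontrivial X := ⟨⟨y, x, h⟩⟩
      exact Finite.one_lt_card
    let e2 := e1.trans (Equiv.swap (e1 y) ⟨1, htwo⟩)
    have h2 : e2 y = ⟨1, htwo⟩ := by simp [e2]
    have h3 : e2 x = ⟨0, hpos⟩ := by
      have ha : e1 x ≠ e1 y := fun e => h (e1.injective e).symm
      have hb : e1 x ≠ ⟨1, htwo⟩ := by rw [h1]; simp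
      simp only [e2, Equiv.trans_apply]
      rw [Equiv.swap_apply_of_ne_of_ne ha hb, h1]
    refine ⟨e2, fun z => ?_⟩
    have hz0 : (e2 z).val = 0 ↔ z = x := by
      rw [← e2.injective.eq_iff, h3, Fin.ext_iff]
    have hz1 : (e2 z).val = 1 ↔ z = y := by
      rw [← e2.injective.eq_iff, h2, Fin.ext_iff]
    refine ⟨hz0, ?_⟩
    rw [← hz0, ← hz1]
    omega

/-- A finite type with an equivalence relation all of whose classes have `k` elements. -/
theorem exists_equiv_prod_of_classes {X : Type*} [Finite X] (s : Setoid X) (k : ℕ)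
    (hk : ∀ x, Nat.card {y // s y x} = k) {ι : Type*} (ρ : X → ι) (hρ : ∀ x y, s x y → ρ x = ρ y) :
    ∃ (a : ι → ℕ) (M : X ≃ (Σ i, Fin (a i)) × Fin k), (∀ x, (M x).1.1 = ρ x) ∧
      ∀ x y, (M x).1 = (M y).1 ↔ s x y := by
  classical
  let Q := Quotient s
  let ρ' : Q → ι := Quotient.lift ρ hρ
  let a : ι → ℕ := fun i => Nat.card {q : Q // ρ' q = i}
  let E : Q ≃ Σ i, Fin (a i) := (Equiv.sigmaFiberEquiv ρ').symm.trans
    (Equiv.sigmaCongrRight fun i => Finite.equivFin _)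
  have hfib : ∀ q : Q, Nonempty ({x : X // Quotient.mk s x = q} ≃ Fin k) := by
    intro q
    induction q using Quotient.inductionOn with | _ x
    refine ⟨Finite.equivFinOfCardEq ?_⟩
    rw [← hk x]
    exact Nat.card_congr (Equiv.subtypeEquivRight fun y => Quotient.eq)
  let F := fun q => (hfib q).some
  let M : X ≃ (Σ i, Fin (a i)) × Fin k :=
    (Equiv.sigmaFiberEquiv (Quotient.mk s)).symm.trans
      ((Equiv.sigmaCongrRight F).trans ((Equiv.sigmaEquivProd Q (Fin k)).trans
        (Equiv.prodCongrLeft fun _ => E)))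
  have hM : ∀ x, (M x).1 = E (Quotient.mk s x) := fun x => rfl
  refine ⟨a, M, fun x => ?_, fun x y => ?_⟩
  · rw [hM]
    rfl
  · rw [hM, hM, E.injective.eq_iff]
    exact Quotient.eq

/-- Each class is enumerated with `c i` first and `d i` second, as in `wGraph`. On `T`, "equal or
adjacent" is an equivalence relation with classes of size three, and these become the added
triangles. -/
theorem IsXiShape.exists_iso {V : Type*} [Finite V] {G : SimpleGraph V} {c d : Fin 4 → V}
    {ρ : V → Fin 4} {T : Set V} (h : IsXiShape G c d ρ T) :
    ∃ a, Nonempty (G ≃g xiGraph (fun i => {p | p ∉ T ∧ ρ p = i}.ncard) a) := by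
  classical
  let W : Fin 4 → Type _ := fun i => {p | p ∉ T ∧ ρ p = i}
  let m : Fin 4 → ℕ := fun i => {p | p ∉ T ∧ ρ p = i}.ncard
  have he : ∀ i, ∃ e : W i ≃ Fin (m i), ∀ z : W i, ((e z).val = 0 ↔ z.1 = c i) ∧
      ((e z).val < 2 ↔ z.1 = c i ∨ z.1 = d i) := by
    intro i
    obtain ⟨e, he⟩ := exists_equiv_fin_of_two (X := W i) ⟨c i, h.c_notMem i, h.root_c i⟩
      ⟨d i, h.d_notMem i, h.root_d i⟩ (by
        intro hdc z
        have hdc' : d i = c i := congrArg Subtype.val hdc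
        obtain ⟨z, hz, rfl⟩ := z
        exact Subtype.ext (h.eq_of_d_eq z hz hdc'))
    refine ⟨e, fun z => ?_⟩
    exact ⟨(he z).1.trans Subtype.ext_iff,
      (he z).2.trans (or_congr Subtype.ext_iff Subtype.ext_iff)⟩
  choose e he0 he2 using fun i => he i
  let L0 : {p // p ∉ T} ≃ Σ i, W i :=
    { toFun := fun p => ⟨ρ p.1, ⟨p.1, p.2, rfl⟩⟩
      invFun := fun x => ⟨x.2.1, x.2.2.1⟩
      left_inv := fun p => rfl
      right_inv := by
        rintro ⟨_, p, hp, rfl⟩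
        rfl }
  let L : {p // p ∉ T} ≃ Σ i, Fin (m i) := L0.trans (Equiv.sigmaCongrRight e)
  have hL : ∀ p : {p // p ∉ T}, L p = ⟨ρ p.1, e (ρ p.1) ⟨p.1, p.2, rfl⟩⟩ := fun p => rfl
  have hL0 : ∀ p : {p // p ∉ T}, (L p).2.val = 0 ↔ p.1 = c (ρ p.1) := fun p => he0 _ _
  let s : Setoid {p // p ∈ T} :=
    { r := fun p q => p = q ∨ G.Adj p.1 q.1
      iseqv := by
        refine ⟨fun p => Or.inl rfl, ?_, ?_⟩
        · rintro p q (rfl | hpq)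
          exacts [Or.inl rfl, Or.inr hpq.symm]
        · rintro p q r (rfl | hpq) (rfl | hqr)
          · exact Or.inl rfl
          · exact Or.inr hqr
          · exact Or.inr hpq
          · by_cases hpr : p = r
            · exact Or.inl hpr
            · exact Or.inr (h.trans p q r p.2 q.2 r.2 hpq hqr fun e => hpr (Subtype.ext e)) }
  have hs : ∀ p q, s p q ↔ p = q ∨ G.Adj p.1 q.1 := fun _ _ => Iff.rfl
  obtain ⟨a, M, hM1, hM2⟩ := exists_equiv_prod_of_classes s 3 (by
    intro x
    obtain ⟨a, b, ha, hb, hab, hadj⟩ := h.two x.1 x.2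
    have hset : {y | s y x} = ({x, ⟨a, ha⟩, ⟨b, hb⟩} : Set {p // p ∈ T}) := by
      ext y
      have := hadj y.1 y.2
      simp only [Set.mem_ofPred_eq, hs, Set.mem_insert_iff, Set.mem_singleton_iff, Subtype.ext_iff]
      rw [G.adj_comm, this]
    have hxa : x.1 ≠ a := ((hadj a ha).2 (Or.inl rfl)).ne
    have hxb : x.1 ≠ b := ((hadj b hb).2 (Or.inr rfl)).ne
    change {y | s y x}.ncard = 3
    rw [hset, Set.ncard_insert_of_notMem, Set.ncard_insert_of_notMem, Set.ncard_singleton]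
    · simp [Subtype.ext_iff, hab]
    · simp [Subtype.ext_iff, hxa, hxb]) (fun p => ρ p.1) (by
    rintro x y (rfl | hxy)
    · rfl
    · exact h.root_eq _ _ x.2 y.2 hxy)
  let Φ : V ≃ (Σ i, Fin (m i)) ⊕ ((Σ i, Fin (a i)) × Fin 3) :=
    (Equiv.sumCompl (fun p => p ∈ T)).symm.trans
      ((Equiv.sumComm _ _).trans (Equiv.sumCongr L M))
  have hΦl : ∀ p (hp : p ∉ T), Φ p = .inl (L ⟨p, hp⟩) := by
    intro p hp
    simp [Φ, Equiv.sumCompl_symm_apply_of_neg (p := fun p => p ∈ T) hp]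
  have hΦr : ∀ p (hp : p ∈ T), Φ p = .inr (M ⟨p, hp⟩) := by
    intro p hp
    simp [Φ, Equiv.sumCompl_symm_apply_of_pos (p := fun p => p ∈ T) hp]
  have hmixed : ∀ p q, p ∉ T → q ∈ T → ((xiGraph m a).Adj (Φ p) (Φ q) ↔ G.Adj p q) := by
    intro p q hp hq
    rw [hΦl p hp, hΦr q hq, xiGraph_adj_inl_inr, h.adj_mixed p q hp hq, hM1, hL0]
    change p = c (ρ p) ∧ ρ p = ρ q ↔ p = c (ρ q)
    constructor
    · rintro ⟨h1, h2⟩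
      rwa [h2] at h1
    · intro h1
      have : ρ p = ρ q := by rw [h1, h.root_c]
      exact ⟨this ▸ h1, this⟩
  refine ⟨a, ⟨⟨Φ, ?_⟩⟩⟩
  intro p q
  change (xiGraph m a).Adj (Φ p) (Φ q) ↔ G.Adj p q
  by_cases hp : p ∈ T
  · by_cases hq : q ∈ T
    · rw [hΦr p hp, hΦr q hq, xiGraph_adj_inr_inr, hM2, hs, M.injective.ne_iff]
      constructor
      · rintro ⟨h1, h2⟩
        exact h2.resolve_left h1
      · intro hpq
        exact ⟨fun e => hpq.ne (congrArg Subtype.val e), Or.inr hpq⟩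
    · rw [adj_comm, hmixed q p hq hp, adj_comm]
  · by_cases hq : q ∈ T
    · exact hmixed p q hp hq
    · rw [hΦl p hp, hΦl q hq, xiGraph_adj_inl_inl]
      by_cases hρ : ρ p = ρ q
      · obtain ⟨i, hi⟩ : ∃ i, ρ p = i := ⟨_, rfl⟩
        have hi' : ρ q = i := hρ ▸ hi
        have hLi : ∀ (t : V) (ht : t ∉ T) (hti : ρ t = i), L ⟨t, ht⟩ = ⟨i, e i ⟨t, ht, hti⟩⟩ := by
          rintro t ht rfl
          rfl
        rw [hLi p hp hi, hLi q hq hi', omegaGraph_adj_same, he2, he2, (e i).injective.ne_iff,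
          h.adj_same p q hp hq i hi hi', Ne, Subtype.ext_iff]
      · rw [omegaGraph_adj_diff m (show (L ⟨p, hp⟩).1 ≠ (L ⟨q, hq⟩).1 from hρ), hL0, hL0,
          h.adj_diff p q hp hq hρ]

/-! ### Counting the edges of `Ξ` -/

theorem two_mul_ncard_edgeSet {V : Type*} [Fintype V] (G : SimpleGraph V) [DecidableRel G.Adj] :
    2 * G.edgeSet.ncard = ∑ p, ∑ q, if G.Adj p q then 1 else 0 := by
  classical
  rw [← coe_edgeFinset, Set.ncard_coe_finset, ← G.sum_degrees_eq_twice_card_edges]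
  refine Finset.sum_congr rfl fun p _ => ?_
  rw [← Finset.card_filter, ← card_neighborFinset_eq_degree]
  congr 1
  ext q
  simp

theorem sum_wGraph (k : ℕ) : (∑ x : Fin (k + 2), ∑ y : Fin (k + 2),
    if x ≠ y ∧ (x.val < 2 ∨ y.val < 2) then 1 else 0) + 6 = 4 * (k + 2) := by
  simp only [Fin.sum_univ_succ, Fin.val_zero, Fin.val_succ, ne_eq, Fin.succ_inj]
  simp [Fin.ext_iff]
  ring

/-- `W_m` has `2m - 3` edges for `m ≥ 2`, while for `m = 1` the count 0 exceeds this formula by one.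
The core adds 6 edges to the total `2 ∑ m i - 12`, and an added triangle brings 6 edges for its 3
vertices. -/
theorem ncard_edgeSet_xiGraph (m a : Fin 4 → ℕ) (hm : ∀ i, 0 < m i) :
    (xiGraph m a).edgeSet.ncard + 6 =
      2 * (∑ i, m i + 3 * ∑ i, a i) + ∑ i, if m i = 1 then 1 else 0 := by
  classical
  have hw : ∀ i, (∑ x : Fin (m i), ∑ y : Fin (m i),
      if x ≠ y ∧ (x.val < 2 ∨ y.val < 2) then 1 else 0) + 6 =
        4 * m i + 2 * if m i = 1 then 1 else 0 := by
    intro i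
    have := hm i
    obtain h | ⟨k, h⟩ : m i = 1 ∨ ∃ k, m i = k + 2 := by
      by_cases h : m i = 1
      · exact Or.inl h
      · exact Or.inr ⟨m i - 2, by omega⟩
    · rw [h]
      simp
    · rw [h, sum_wGraph]
      simp
  have hzero : ∀ i, (∑ x : Fin (m i), if x.val = 0 then 1 else 0) = 1 := by
    intro i
    obtain ⟨k, hk⟩ : ∃ k, m i = k + 1 := ⟨m i - 1, by have := hm i; omega⟩
    rw [hk, Fin.sum_univ_succ]
    simp
  have hoo : (∑ p : Σ i, Fin (m i), ∑ q : Σ i, Fin (m i),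
      if (omegaGraph m).Adj p q then 1 else 0) + 12 =
        4 * ∑ i, m i + 2 * ∑ i, if m i = 1 then 1 else 0 := by
    have hij : ∀ i j, (∑ x : Fin (m i), ∑ y : Fin (m j),
        if (omegaGraph m).Adj ⟨i, x⟩ ⟨j, y⟩ then 1 else 0) =
        if i = j then (∑ x : Fin (m i), ∑ y : Fin (m i),
          if x ≠ y ∧ (x.val < 2 ∨ y.val < 2) then 1 else 0) else 1 := by
      intro i j
      split_ifs with hij
      · subst hij
        simp only [omegaGraph_adj_same]
      · have : ∀ (x : Fin (m i)) (y : Fin (m j)),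
            (if (omegaGraph m).Adj ⟨i, x⟩ ⟨j, y⟩ then 1 else 0) =
              (if x.val = 0 then 1 else 0) * (if y.val = 0 then 1 else 0) := by
          intro x y
          simp only [omegaGraph_adj_diff m (p := ⟨i, x⟩) (q := ⟨j, y⟩) hij]
          split_ifs <;> simp_all
        simp only [this, ← Finset.mul_sum, hzero, mul_one]
    simp only [Fintype.sum_sigma]
    -- The defect 6 of the `i`-th block drops to 3, since `c i` is adjacent to the three other core
    -- vertices.
    have : ∀ i, (∑ x : Fin (m i), ∑ j, ∑ y : Fin (m j),
        if (omegaGraph m).Adj ⟨i, x⟩ ⟨j, y⟩ then 1 else 0) + 3 =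
          4 * m i + 2 * if m i = 1 then 1 else 0 := by
      intro i
      rw [Finset.sum_comm]
      simp only [hij]
      have h3 := hw i
      revert h3
      generalize (∑ x : Fin (m i), ∑ y : Fin (m i),
        if x ≠ y ∧ (x.val < 2 ∨ y.val < 2) then 1 else 0) = S
      generalize (4 * m i + 2 * if m i = 1 then 1 else 0) = R
      intro h3
      fin_cases i <;> simp [Fin.sum_univ_four] <;> omega
    have h4 := Finset.sum_congr (rfl : (Finset.univ : Finset (Fin 4)) = _) fun i _ => this i
    rw [Finset.sum_add_distrib, Finset.sum_add_distrib, ← Finset.mul_sum, ← Finset.mul_sum] at h4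
    simpa using h4
  have hot : (∑ p : Σ i, Fin (m i), ∑ t : (Σ i : Fin 4, Fin (a i)) × Fin 3,
      if p.2.val = 0 ∧ p.1 = t.1.1 then 1 else 0) = 3 * ∑ i, a i := by
    rw [Finset.sum_comm]
    have : ∀ t : (Σ i : Fin 4, Fin (a i)) × Fin 3, (∑ p : Σ i, Fin (m i),
        if p.2.val = 0 ∧ p.1 = t.1.1 then 1 else 0) = 1 := by
      intro t
      rw [Fintype.sum_sigma]
      have : ∀ i, (∑ x : Fin (m i), if x.val = 0 ∧ i = t.1.1 then 1 else 0) =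
          if i = t.1.1 then 1 else 0 := by
        intro i
        by_cases h : i = t.1.1
        · simp only [h, and_true, if_true, hzero]
        · simp [h]
      simp only [this]
      simp
    simp only [this]
    simp [mul_comm]
  have htt : (∑ s : (Σ i : Fin 4, Fin (a i)) × Fin 3, ∑ t : (Σ i : Fin 4, Fin (a i)) × Fin 3,
      if s ≠ t ∧ s.1 = t.1 then 1 else 0) = 6 * ∑ i, a i := by
    have : ∀ s : (Σ i : Fin 4, Fin (a i)) × Fin 3, (∑ t : (Σ i : Fin 4, Fin (a i)) × Fin 3,
        if s ≠ t ∧ s.1 = t.1 then 1 else 0) = 2 := by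
      intro s
      rw [Fintype.sum_prod_type]
      have : ∀ q, (∑ j : Fin 3, if s ≠ (q, j) ∧ s.1 = q then 1 else 0) =
          if s.1 = q then 2 else 0 := by
        intro q
        obtain ⟨s1, s2⟩ := s
        by_cases h : s1 = q
        · subst h
          fin_cases s2 <;> simp [Fin.sum_univ_three]
        · simp [h]
      simp only [this]
      simp
    simp only [this]
    simp
    ring
  have h2 := two_mul_ncard_edgeSet (xiGraph m a)
  simp only [Fintype.sum_sum_type, xiGraph_adj_inl_inl, xiGraph_adj_inl_inr, xiGraph_adj_inr_inr,
    (xiGraph m a).adj_comm (Sum.inr _) (Sum.inl _), Finset.sum_add_distrib] at h2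
  have hto := Finset.sum_comm.trans hot
  rw [hot, htt, hto] at h2
  omega

/-! ### The upper bound for `rsat` -/

/-- The neighbors of a vertex of `K₄` with three pendant triangles and one graph `W₆` attached to
its vertices `0, …, 3`; the vertices `11, …, 14` are the vertices of degree two of `W₆`. -/
def modelNbrs : ℕ → List ℕ
  | 0 => [1, 2, 3, 4, 11, 12, 13, 14]
  | 1 => [0, 2, 3, 5, 6]
  | 2 => [0, 1, 3, 7, 8]
  | 3 => [0, 1, 2, 9, 10]
  | 4 => [0, 11, 12, 13, 14]
  | 5 => [1, 6]
  | 6 => [1, 5]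
  | 7 => [2, 8]
  | 8 => [2, 7]
  | 9 => [3, 10]
  | 10 => [3, 9]
  | _ => [0, 4]

/-- Searches for a path with four edges from `p` to `q` which avoids the edge `rs`. -/
def modelPath (p q r s : ℕ) : Bool :=
  let ok := fun a b : ℕ => !((a == r && b == s) || (a == s && b == r))
  (modelNbrs p).any fun x => ok p x && x != q &&
    (modelNbrs x).any fun y => ok x y && y != p && y != q &&
      (modelNbrs y).any fun z => ok y z && z != p && z != x && ok z q && (modelNbrs z).contains q

theorem modelPath_eq_true : ((List.range 15).all fun p => (List.range 15).all fun q =>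
    p == q || (modelNbrs p).contains q || (List.range 15).all fun r => (modelNbrs r).all fun s =>
      modelPath p q r s) = true := by
  decide +kernel

theorem modelNbrs_lt : ∀ x < 15, ∀ y ∈ modelNbrs x, y < 15 := by decide

/-- The vertices from 11 on are twins; truncation at 11 identifies them, which permits any number of
them in `modelGraph`. -/
theorem mem_modelNbrs_iff_min : ∀ x < 15, ∀ y < 15,
    y ∈ modelNbrs x ↔ min y 11 ∈ modelNbrs (min x 11) := by decide

theorem modelNbrs_symm : ∀ x ≤ 11, ∀ y ≤ 11, y ∈ modelNbrs x → x ∈ modelNbrs y := by decide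

theorem modelNbrs_irrefl : ∀ x ≤ 11, x ∉ modelNbrs x := by decide

/-- A 5-cycle of any `modelGraph` truncates to a closed walk in which only 11 may repeat, so this
search over 12 indices covers all sizes. -/
theorem model_no_cycle : ((List.range 12).all fun a => ((modelNbrs a).filter (· < 12)).all fun b =>
    ((modelNbrs b).filter (· < 12)).all fun c => (a == c && a != 11) ||
    ((modelNbrs c).filter (· < 12)).all fun d => (a == d && a != 11) || (b == d && b != 11) ||
    ((modelNbrs d).filter (· < 12)).all fun e => (b == e && b != 11) || (c == e && c != 11) ||
      !((modelNbrs e).contains a)) = true := by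
  decide +kernel

/-- The graph obtained from `K₄` with three pendant triangles and one graph `W_{k + 2}` attached
to its vertices. -/
def modelGraph (k : ℕ) : SimpleGraph (Fin (11 + k)) where
  Adj x y := min y.val 11 ∈ modelNbrs (min x.val 11)
  symm := ⟨fun _ _ h => modelNbrs_symm _ (min_le_right _ _) _ (min_le_right _ _) h⟩
  loopless := ⟨fun _ h => modelNbrs_irrefl _ (min_le_right _ _) h⟩

theorem modelGraph_adj {k : ℕ} {x y : Fin (11 + k)} :
    (modelGraph k).Adj x y ↔ min y.val 11 ∈ modelNbrs (min x.val 11) := Iff.rfl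

instance (k : ℕ) : DecidableRel (modelGraph k).Adj := fun _ _ =>
  decidable_of_iff _ modelGraph_adj.symm

theorem cycleFiveFree_modelGraph (k : ℕ) : CycleFiveFree (modelGraph k) := by
  intro a b c d e _ ac ad _ _ bd be _ ce _ hab hbc hcd hde hea
  rw [modelGraph_adj] at hab hbc hcd hde hea
  have hne : ∀ x y : Fin (11 + k), x ≠ y →
      (min x.val 11 == min y.val 11 && min x.val 11 != 11) = false := by
    intro x y hxy
    have : x.val ≠ y.val := fun h => hxy (Fin.ext h)
    by_contra h
    rw [Bool.not_eq_false] at h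
    simp only [Bool.and_eq_true, beq_iff_eq, bne_iff_ne] at h
    omega
  have hlt : ∀ x : Fin (11 + k), min x.val 11 < 12 := fun x => by omega
  have hmem : ∀ {x : ℕ} {y : Fin (11 + k)}, min y.val 11 ∈ modelNbrs x →
      min y.val 11 ∈ (modelNbrs x).filter (· < 12) := fun {x y} h =>
    List.mem_filter.2 ⟨h, decide_eq_true (hlt y)⟩
  have h := model_no_cycle
  rw [List.all_eq_true] at h
  have h := h _ (List.mem_range.2 (hlt a))
  rw [List.all_eq_true] at h
  have h := h _ (hmem hab)
  rw [List.all_eq_true] at h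
  have h := h _ (hmem hbc)
  rw [hne a c ac, Bool.false_or, List.all_eq_true] at h
  have h := h _ (hmem hcd)
  rw [hne a d ad, hne b d bd, Bool.false_or, Bool.false_or, List.all_eq_true] at h
  have h := h _ (hmem hde)
  rw [hne b e be, hne c e ce, Bool.false_or, Bool.false_or] at h
  rw [List.contains_iff_mem.2 hea] at h
  exact absurd h (by decide)

theorem exists_path_of_modelPath {p q r s : ℕ} (h : modelPath p q r s = true) :
    ∃ x ∈ modelNbrs p, ∃ y ∈ modelNbrs x, ∃ z ∈ modelNbrs y, q ∈ modelNbrs z ∧ x ≠ q ∧ y ≠ p ∧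
      y ≠ q ∧ z ≠ p ∧ z ≠ x ∧ ∀ a b, (a = p ∧ b = x) ∨ (a = x ∧ b = y) ∨ (a = y ∧ b = z) ∨
        (a = z ∧ b = q) → ¬ ((a = r ∧ b = s) ∨ (a = s ∧ b = r)) := by
  simp only [modelPath, List.any_eq_true, Bool.and_eq_true, Bool.not_eq_true', bne_iff_ne,
    Bool.or_eq_false_iff, List.contains_iff_mem] at h
  obtain ⟨x, hx, ⟨o1, n1⟩, y, hy, ⟨⟨o2, n2⟩, n3⟩, z, hz, ⟨⟨⟨o3, n4⟩, n5⟩, o4⟩, hq⟩ := h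
  refine ⟨x, hx, y, hy, z, hz, hq, n1, n2, n3, n4, n5, ?_⟩
  simp only [Bool.and_eq_false_iff, beq_eq_false_iff_ne] at o1 o2 o3 o4
  have key : ∀ {a b : ℕ}, (a ≠ r ∨ b ≠ s) ∧ (a ≠ s ∨ b ≠ r) →
      ¬ ((a = r ∧ b = s) ∨ (a = s ∧ b = r)) := by
    rintro a b ⟨h1, h2⟩ (⟨h3, h4⟩ | ⟨h3, h4⟩)
    · exact h1.elim (· h3) (· h4)
    · exact h2.elim (· h3) (· h4)
  rintro a b (⟨rfl, rfl⟩ | ⟨rfl, rfl⟩ | ⟨rfl, rfl⟩ | ⟨rfl, rfl⟩)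
  exacts [key o1, key o2, key o3, key o4]

/-- Four of the vertices of degree two of `W_{k + 2}` can be chosen so as to include three given
ones. -/
theorem exists_modelEmbedding {k : ℕ} (hk : 4 ≤ k) (p q s : Fin (11 + k)) :
    ∃ j : ℕ → Fin (11 + k), (∀ x < 15, ∀ y < 15, j x = j y → x = y) ∧
      (∀ x < 15, min (j x).val 11 = min x 11) ∧
      ∀ t : Fin (11 + k), t.val < 11 ∨ t = p ∨ t = q ∨ t = s → ∃ x < 15, j x = t := by
  classical
  let leaves : Finset (Fin (11 + k)) := Finset.univ.map (Fin.natAddEmb 11)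
  have hl : ∀ t, t ∈ leaves ↔ 11 ≤ t.val := by
    intro t
    simp only [leaves, Finset.mem_map, Finset.mem_univ, true_and, Fin.natAddEmb_apply]
    constructor
    · rintro ⟨a, rfl⟩
      simp
    · intro h
      exact ⟨⟨t.val - 11, by omega⟩, Fin.ext (by simp; omega)⟩
  have hlc : leaves.card = k := by simp [leaves]
  let S : Finset (Fin (11 + k)) := ({p, q, s} : Finset _).filter (· ∈ leaves)
  have hS : S.card ≤ 3 := (Finset.card_filter_le _ _).trans Finset.card_le_three
  -- The at most three prescribed leaves are filled up to four; this is where `4 ≤ k` is needed.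
  obtain ⟨T, hST, hT, hTc⟩ := Finset.exists_subsuperset_card_eq (s := S) (t := leaves) (n := 4)
    (fun t ht => (Finset.mem_filter.1 ht).2) (by omega) (by omega)
  let g := T.orderEmbOfFin hTc
  have hg : ∀ i, 11 ≤ (g i).val := fun i => (hl _).1 (hT (T.orderEmbOfFin_mem hTc i))
  let j : ℕ → Fin (11 + k) := fun x =>
    if h : x < 11 then ⟨x, by omega⟩ else if h' : x - 11 < 4 then g ⟨x - 11, h'⟩ else ⟨0, by omega⟩
  have j1 : ∀ x, x < 11 → (j x).val = x := fun x hx => by simp [j, hx]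
  have j2 : ∀ x (hx : 11 ≤ x) (hx' : x < 15), j x = g ⟨x - 11, by omega⟩ := by
    intro x hx hx'
    have h1 : ¬ x < 11 := by omega
    have h2 : x - 11 < 4 := by omega
    simp [j, h1, h2]
  refine ⟨j, ?_, ?_, ?_⟩
  · intro x hx y hy hxy
    by_cases h1 : x < 11 <;> by_cases h2 : y < 11
    · rw [← j1 x h1, ← j1 y h2, hxy]
    · have h3 := hg ⟨y - 11, by omega⟩
      rw [← j2 y (by omega) hy, ← hxy, j1 x h1] at h3
      omega
    · have h3 := hg ⟨x - 11, by omega⟩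
      rw [← j2 x (by omega) hx, hxy, j1 y h2] at h3
      omega
    · rw [j2 x (by omega) hx, j2 y (by omega) hy] at hxy
      have := Fin.ext_iff.1 (g.injective hxy)
      simp only at this
      omega
  · intro x hx
    by_cases h1 : x < 11
    · rw [j1 x h1]
    · rw [j2 x (by omega) hx]
      have := hg ⟨x - 11, by omega⟩
      omega
  · intro t ht
    by_cases h : t.val < 11
    · exact ⟨t.val, by omega, Fin.ext (j1 _ h)⟩
    · have htT : t ∈ T := hST (Finset.mem_filter.2
        ⟨by simpa using ht.resolve_left h, (hl t).2 (by omega)⟩)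
      have : t ∈ Set.range g := by
        rw [Finset.range_orderEmbOfFin]
        exact htT
      obtain ⟨i, rfl⟩ := this
      refine ⟨i.val + 11, by omega, ?_⟩
      rw [j2 _ (by omega) (by omega)]
      congr 1

/-- The leaves of `W_{k + 2}` are independent, so a pair of vertices and an edge involve at most
three of them and lie in a 15-vertex copy of the case `k = 4`. That case is `modelPath_eq_true`. -/
theorem pathSaturated_modelGraph {k : ℕ} (hk : 4 ≤ k) : PathSaturated (modelGraph k) := by
  intro p q hpq hn e
  suffices main : ∀ r s : Fin (11 + k), (modelGraph k).Adj r s → r.val < 11 →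
      ∃ x y z, IsPathAvoiding (modelGraph k) s(r, s) p x y z q by
    by_cases he : e ∈ (modelGraph k).edgeSet
    · induction e with | _ r s
      have hrs : (modelGraph k).Adj r s := he
      by_cases hr : r.val < 11
      · exact main r s hrs hr
      · have hs : s.val < 11 := by
          by_contra hs
          rw [modelGraph_adj, min_eq_right (by omega), min_eq_right (by omega)] at hrs
          exact absurd hrs (by decide)
        rw [Sym2.eq_swap]
        exact main s r hrs.symm hs
    -- If `e` is not an edge, every path avoids it, so any edge, here `01`, may be forbidden
    -- instead.
    · obtain ⟨x, y, z, P⟩ := main ⟨0, by omega⟩ ⟨1, by omega⟩ (by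
        change min 1 11 ∈ modelNbrs (min 0 11)
        decide) (by simp)
      refine ⟨x, y, z, { P with e1 := ?_, e2 := ?_, e3 := ?_, e4 := ?_ }⟩ <;> rintro rfl <;>
        apply he
      exacts [P.px, P.xy, P.yz, P.zq]
  intro r s hrs hr
  obtain ⟨j, jinj, jmin, jsurj⟩ := exists_modelEmbedding hk p q s
  have hadj : ∀ x < 15, ∀ y < 15, (modelGraph k).Adj (j x) (j y) ↔ y ∈ modelNbrs x := by
    intro x hx y hy
    rw [modelGraph_adj, jmin x hx, jmin y hy, mem_modelNbrs_iff_min x hx y hy]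
  obtain ⟨p, hp, rfl⟩ := jsurj p (by simp)
  obtain ⟨q, hq, rfl⟩ := jsurj q (by simp)
  obtain ⟨s, hs, rfl⟩ := jsurj s (by simp)
  obtain ⟨r, hr', rfl⟩ := jsurj r (by simp [hr])
  rw [hadj r hr' s hs] at hrs
  rw [hadj p hp q hq] at hn
  have h := modelPath_eq_true
  rw [List.all_eq_true] at h
  have h := h p (List.mem_range.2 hp)
  rw [List.all_eq_true] at h
  have h := h q (List.mem_range.2 hq)
  simp only [Bool.or_eq_true, beq_iff_eq, List.contains_iff_mem] at h
  have h := (h.resolve_left fun h => h.elim (fun h => hpq (congrArg j h)) hn)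
  rw [List.all_eq_true] at h
  have h := h r (List.mem_range.2 hr')
  rw [List.all_eq_true] at h
  obtain ⟨x, px, y, xy, z, yz, zq, xq, yp, yq, zp, zx, hav⟩ := exists_path_of_modelPath (h s hrs)
  have hx := modelNbrs_lt p hp x px
  have hy := modelNbrs_lt x hx y xy
  have hz := modelNbrs_lt y hy z yz
  have hne : ∀ {a b : ℕ}, a < 15 → b < 15 → a ≠ b → j a ≠ j b := fun ha hb h e =>
    h (jinj _ ha _ hb e)
  have hedge : ∀ {a b : ℕ}, a < 15 → b < 15 → ((a = p ∧ b = x) ∨ (a = x ∧ b = y) ∨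
      (a = y ∧ b = z) ∨ (a = z ∧ b = q)) → s(j r, j s) ≠ s(j a, j b) := by
    intro a b ha hb hab he
    apply hav a b hab
    rcases Sym2.eq_iff.1 he with ⟨h1, h2⟩ | ⟨h1, h2⟩
    · exact Or.inl ⟨(jinj _ hr' _ ha h1).symm, (jinj _ hs _ hb h2).symm⟩
    · exact Or.inr ⟨(jinj _ hs _ ha h2).symm, (jinj _ hr' _ hb h1).symm⟩
  exact ⟨j x, j y, j z, (hadj _ hp _ hx).2 px, (hadj _ hx _ hy).2 xy, (hadj _ hy _ hz).2 yz,
    (hadj _ hz _ hq).2 zq, hne hp hy yp.symm, hne hp hz zp.symm, hpq, hne hx hz zx.symm,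
    hne hx hq xq, hne hy hq yq, hedge hp hx (by simp), hedge hx hy (by simp),
    hedge hy hz (by simp), hedge hz hq (by simp)⟩

theorem ncard_edgeSet_modelGraph (k : ℕ) : (modelGraph k).edgeSet.ncard = 2 * k + 16 := by
  have h := two_mul_ncard_edgeSet (modelGraph k)
  have hc : ∀ i : Fin 11, min (Fin.castAdd k i).val 11 = i.val := fun i => by
    rw [Fin.val_castAdd]
    omega
  have hn : ∀ i : Fin k, min (Fin.natAdd 11 i).val 11 = 11 := fun i => by
    rw [Fin.val_natAdd]
    omega
  simp only [Fin.sum_univ_add, modelGraph_adj, hc, hn, Finset.sum_add_distrib, Finset.sum_const,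
    Finset.card_univ, Fintype.card_fin, smul_eq_mul] at h
  have h1 : (∑ x : Fin 11, ∑ y : Fin 11, if y.val ∈ modelNbrs x.val then 1 else 0) = 32 := by
    decide
  have h2 : (∑ x : Fin 11, k * if 11 ∈ modelNbrs x.val then 1 else 0) = 2 * k := by
    rw [← Finset.mul_sum, show (∑ x : Fin 11, if 11 ∈ modelNbrs x.val then 1 else 0) = 2 by decide,
      mul_comm]
  have h3 : (∑ x : Fin 11, if x.val ∈ modelNbrs 11 then 1 else 0) = 2 := by decide
  have h4 : (if 11 ∈ modelNbrs 11 then 1 else 0) = 0 := by decide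
  rw [h1, h2, h3, h4] at h
  omega

theorem rsat_cycleGraph_five_le {n : ℕ} (hn : 15 ≤ n) : rsat n (cycleGraph 5) ≤ 2 * n - 6 := by
  obtain ⟨k, rfl⟩ : ∃ k, n = 11 + k := ⟨n - 11, by omega⟩
  obtain ⟨c, hc⟩ := exists_injective_nat (modelGraph k).edgeSet
  refine Nat.sInf_le ⟨modelGraph k, ⟨c, isRainbowSaturated_of_pathSaturated hc
    (cycleFiveFree_modelGraph k) (pathSaturated_modelGraph (by omega))⟩, ?_⟩
  rw [ncard_edgeSet_modelGraph]
  omega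

/-! ### Conclusion -/

theorem RainbowSat.IsBadRoot.exists_pendantTriangle {V : Type*} {G : SimpleGraph V} {u : V}
    (h : IsBadRoot G u) : ∃ v w, PendantTriangle G u v w := by
  obtain ⟨-, v, w, hu, hv⟩ := h
  refine ⟨v, w, fun t => ?_, fun t => ?_⟩
  · rw [← mem_neighborSet, hu]
    rfl
  · rw [← mem_neighborSet, hv]
    rfl

theorem PendantTriangle.exists_iso_xiGraph {V : Type*} [Finite V] {G : SimpleGraph V}
    {u v w t : V} (hp : PendantTriangle G u v w) (hf : CycleFiveFree G) (hs : PathSaturated G)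
    (tu : t ≠ u) (tv : t ≠ v) (tw : t ≠ w) :
    ∃ m a : Fin 4 → ℕ, (∀ i, m i = 1 ∨ m i = 3 ∨ 6 ≤ m i) ∧ (∃ i, m i = 3) ∧
      Nonempty (G ≃g xiGraph m a) := by
  obtain ⟨c, ρ, hc, hc0, hu, hv⟩ := hp.exists_isCore hf hs tu tv tw
  choose d hd using fun i => hc.exists_starCenter hf i
  obtain ⟨a, ha⟩ := (hc.isXiShape hf hs hd).exists_iso
  refine ⟨_, a, fun i => (hc.class_ncard hf hs hd i).1, ⟨0, ?_⟩, ha⟩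
  -- Since `w = c 0`, the edge `uv` is a whole component outside the core, and the class of `w` is
  -- the pendant triangle.
  refine (hc.class_ncard hf hs hd 0).2 u v hu hv ?_ ((hp.left v).2 (Or.inl rfl)) ?_ ?_
  · exact ((hc.adj_core u hu 0).1 ((hp.left _).2 (Or.inr hc0))).symm
  · intro y hy huy
    exact ((hp.left y).1 huy).resolve_right fun e => hy ⟨0, hc0.trans e.symm⟩
  · intro y hy hvy
    exact ((hp.right y).1 hvy).resolve_right fun e => hy ⟨0, hc0.trans e.symm⟩

theorem ncard_edgeSet_eq_of_iso {V W : Type*} {G : SimpleGraph V} {H : SimpleGraph W}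
    (e : G ≃g H) : G.edgeSet.ncard = H.edgeSet.ncard :=
  Nat.card_congr e.mapEdgeSet

theorem card_eq_of_iso_xiGraph {V : Type*} {G : SimpleGraph V} {m a : Fin 4 → ℕ}
    (e : G ≃g xiGraph m a) : Nat.card V = ∑ i, m i + 3 * ∑ i, a i := by
  rw [Nat.card_congr e.toEquiv, Nat.card_eq_fintype_card]
  simp [mul_comm]

theorem theorem1p3 {V : Type*} [Finite V] (n : ℕ) (hn : 15 ≤ n) (hV : Nat.card V = n)
    (G : SimpleGraph V) (hbad : ∃ u : V, RainbowSat.IsBadRoot G u)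
    (R : G.EdgeLabeling ℕ) (hR : Function.Injective R)
    (hsat : RainbowSat.IsRainbowSaturated (SimpleGraph.cycleGraph 5) G R) :
    (RainbowSat.MemRSat n (SimpleGraph.cycleGraph 5) G →
      RainbowSat.rsat n (SimpleGraph.cycleGraph 5) = 2 * n - 6 ∧ RainbowSat.MemFamily n G) ∧
    2 * n - 6 ≤ G.edgeSet.ncard ∧
    (G.edgeSet.ncard = 2 * n - 6 ↔ RainbowSat.MemFamily n G) := by
  classical
  obtain ⟨u, hu⟩ := hbad
  obtain ⟨v, w, hp⟩ := hu.exists_pendantTriangle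
  obtain ⟨t, ht⟩ : ∃ t, t ∉ ({u, v, w} : Set V) := by
    by_contra hcon
    push Not at hcon
    have h1 : (Set.univ : Set V) = {u, v, w} := (Set.eq_univ_of_forall hcon).symm
    have h2 := Set.ncard_univ V
    rw [h1, hV, ← Finset.coe_pair, ← Finset.coe_insert, Set.ncard_coe_finset] at h2
    have h3 : ({u, v, w} : Finset V).card ≤ 3 := Finset.card_le_three
    omega
  simp only [Set.mem_insert_iff, Set.mem_singleton_iff, not_or] at ht
  obtain ⟨m, a, hm, hm3, ⟨e⟩⟩ := hp.exists_iso_xiGraph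
    (cycleFiveFree_of_not_hasRainbowCopy hR hsat.1) (pathSaturated_of_isRainbowSaturated hR hsat)
    ht.1 ht.2.1 ht.2.2
  have hcard := card_eq_of_iso_xiGraph e
  have hedges := ncard_edgeSet_xiGraph m a fun i => by rcases hm i with h | h | h <;> omega
  rw [← ncard_edgeSet_eq_of_iso e, ← hcard, hV] at hedges
  have hlow : 2 * n - 6 ≤ G.edgeSet.ncard := by omega
  have hiff : G.edgeSet.ncard = 2 * n - 6 ↔ MemFamily n G := by
    constructor
    · intro h
      -- Equality leaves no room for a trivial class `m i = 1`.
      have hzero : (∑ i, if m i = 1 then 1 else 0) = 0 := by omega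
      rw [Finset.sum_eq_zero_iff] at hzero
      refine ⟨m, a, fun i => (hm i).resolve_left fun h1 => ?_, hm3, by rw [← hcard, hV], ⟨e⟩⟩
      have := hzero i (Finset.mem_univ i)
      rw [if_pos h1] at this
      exact one_ne_zero this
    · rintro ⟨m', a', hm', -, hsum, ⟨e'⟩⟩
      have h := ncard_edgeSet_xiGraph m' a' fun i => by rcases hm' i with h | h <;> omega
      have hzero : (∑ i, if m' i = 1 then 1 else 0) = 0 :=
        Finset.sum_eq_zero fun i _ => if_neg (by rcases hm' i with h | h <;> omega)
      rw [← ncard_edgeSet_eq_of_iso e', hsum, hzero] at h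
      omega
  refine ⟨fun hmem => ?_, hlow, hiff⟩
  have h1 := hmem.2.2
  have h2 := rsat_cycleGraph_five_le hn
  have h3 : G.edgeSet.ncard = 2 * n - 6 := by omega
  exact ⟨h1.symm.trans h3, hiff.1 h3⟩
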